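/- Let $\Phi_F>0$ and let $K\in C^2(\mathbb R)$ have bounded derivatives $K',K''$ and satisfy $K>0$ on $[0,\Phi_F]$. For $0<T\le+\infty$ and a nondecreasing $Q_{\rm init}\in C^1[0,1]$ with $Q_{\rm init}(0)=0$, $Q_{\rm init}(1)=\Phi_F$, $Q_{\rm init}'(1)>K(\Phi_F)$, a classical solution on $[0,T)$ with initial data $Q_{\rm init}$ is a pair $(Q,N)$, with $Q\in C^1([0,T)\times[0,1])$ nondecreasing in $\eta$ and $N\in C[0,T)$ positive, such that $$\partial_\tau Q+\partial_\eta Q=\frac1{N(\tau)}+K(Q),\qquad Q(\tau,0)=0,\qquad \frac1{N(\tau)}=\partial_\eta Q(\tau,1)-K(\Phi_F),\qquad Q(0,\eta)=Q_{\rm init}(\eta),$$ and $\partial_\eta Q(\tau,1)>K(\Phi_F)$ for all $\tau\in[0,T)$. A steady state is a function $Q^*$ of $\eta\in[0,1]$ which, together with some constant $N^*>0$, is a time-independent classical solution on $[0,+\infty)$. Put $$k_{\min}:=K'(0)+\int_0^{\Phi_F}\min(K''(\phi),0)\,d\phi .$$ Suppose that $k_{\min}>0$ and $\int_0^{\Phi_F}\frac{d\phi}{K(\phi)}>1$.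 Then there is a unique steady state $Q^*$. Moreover, let $Q_{\rm init}\in C^1[0,1]$ be any nondecreasing function with $Q_{\rm init}(0)=0$, $Q_{\rm init}(1)=\Phi_F$, $Q_{\rm init}'(1)>K(\Phi_F)$ and $Q_{\rm init}'(1)-Q_{\rm init}'(0)=K(\Phi_F)-K(0)$ that is not a steady state. Then $\|\partial_\eta Q_{\rm init}-\partial_\eta Q^*\|_{L^1(0,1)}>0$, and the unique maximal classical solution $(Q,N)$ with initial data $Q_{\rm init}$ exists exactly on an interval $[0,\tau^*)$ with $0<\tau^*<+\infty$, its firing rate blows up, $\lim_{\tau\to(\tau^*)^-}N(\tau)=+\infty$, and the blow-up time satisfies $$\tau^*\le\frac1{k_{\min}}\ln\left(\frac{2\Phi_F}{\|\partial_\eta Q_{\rm init}-\partial_\eta Q^*\|_{L^1(0,1)}}\right)<+\infty .$$ -/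

import Mathlib

open Set Filter Topology

/-- Standing assumption on the phase response function `K`: it is `C²` on `ℝ`, its first two
derivatives are bounded on `ℝ`, and it is positive on `[0, ΦF]`. -/
structure IsPhaseResponse (K : ℝ → ℝ) (ΦF : ℝ) : Prop where
  contDiff : ContDiff ℝ 2 K
  bounded_deriv : ∃ C : ℝ, ∀ φ : ℝ, |deriv K φ| ≤ C
  bounded_deriv_two : ∃ C : ℝ, ∀ φ : ℝ, |deriv (deriv K) φ| ≤ C
  pos : ∀ φ ∈ Icc (0 : ℝ) ΦF, 0 < K φ

/-- `k_min = K'(0) + ∫₀^ΦF (K''(φ))₋ dφ`, where `(x)₋ = min x 0`. -/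
noncomputable def kMin (K : ℝ → ℝ) (ΦF : ℝ) : ℝ :=
  deriv K 0 + ∫ φ in (0 : ℝ)..ΦF, min (deriv (deriv K) φ) 0

/-- The time interval `[0, T)`, where `T` may be `+∞`. -/
def timeInterval (T : EReal) : Set ℝ := {τ : ℝ | 0 ≤ τ ∧ (τ : EReal) < T}

/-- The derivative of a function on `[0, 1]`, one-sided at the two end points. -/
noncomputable def dEta (q : ℝ → ℝ) (η : ℝ) : ℝ := derivWithin q (Icc 0 1) η

/-- The time derivative `∂_τ Q (τ, η)` for `τ ≥ 0`, one-sided at `τ = 0`. -/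
noncomputable def dTau (Q : ℝ → ℝ → ℝ) (τ η : ℝ) : ℝ := derivWithin (fun s => Q s η) (Ici 0) τ

/-- The `L¹(0, 1)` distance between the derivatives of two functions on `[0, 1]`. -/
noncomputable def distBV (p q : ℝ → ℝ) : ℝ := ∫ η in (0 : ℝ)..1, |dEta p η - dEta q η|

/-- Conditions on initial data that are part of the notion of classical solution:
a nondecreasing `C¹` function on `[0, 1]` with `q(0) = 0`, `q(1) = ΦF` and `q'(1) > K(ΦF)`. -/
structure IsAdmissibleData (K : ℝ → ℝ) (ΦF : ℝ) (q : ℝ → ℝ) : Prop where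
  contDiffOn : ContDiffOn ℝ 1 q (Icc 0 1)
  monotoneOn : MonotoneOn q (Icc 0 1)
  map_zero : q 0 = 0
  map_one : q 1 = ΦF
  lt_deriv_one : K ΦF < dEta q 1

/-- Admissible initial data that are moreover compatible, to first order, with the boundary
conditions: `q'(1) - q'(0) = K(ΦF) - K(0)`. -/
structure IsCompatibleData (K : ℝ → ℝ) (ΦF : ℝ) (q : ℝ → ℝ) : Prop
    extends IsAdmissibleData K ΦF q where
  compatible : dEta q 1 - dEta q 0 = K ΦF - K 0

/-- `(Q, N)` is a classical solution on `[0, T)`, `0 < T ≤ +∞`, with initial data `Qinit`, of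
`∂_τ Q + ∂_η Q = 1 / N(τ) + K(Q)`, `Q(τ, 0) = 0`, `1 / N(τ) = ∂_η Q(τ, 1) - K(ΦF)`.
The equations are required up to the boundary; for a `C¹` function `Q` and a continuous
positive `N` this is the same as requiring them for `τ > 0` and `0 < η < 1`. -/
structure IsClassicalSolution (K : ℝ → ℝ) (ΦF : ℝ) (Qinit : ℝ → ℝ) (T : EReal)
    (Q : ℝ → ℝ → ℝ) (N : ℝ → ℝ) : Prop where
  data : IsAdmissibleData K ΦF Qinit
  time_pos : 0 < T
  contDiffOn : ContDiffOn ℝ 1 (fun p : ℝ × ℝ => Q p.1 p.2) (timeInterval T ×ˢ Icc 0 1)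
  monotoneOn : ∀ τ ∈ timeInterval T, MonotoneOn (Q τ) (Icc 0 1)
  continuousOn_rate : ContinuousOn N (timeInterval T)
  rate_pos : ∀ τ ∈ timeInterval T, 0 < N τ
  equation : ∀ τ ∈ timeInterval T, ∀ η ∈ Icc (0 : ℝ) 1,
    dTau Q τ η + dEta (Q τ) η = 1 / N τ + K (Q τ η)
  boundary : ∀ τ ∈ timeInterval T, Q τ 0 = 0
  rate_eq : ∀ τ ∈ timeInterval T, 1 / N τ = dEta (Q τ) 1 - K ΦF
  initial : ∀ η ∈ Icc (0 : ℝ) 1, Q 0 η = Qinit η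
  rate_finite : ∀ τ ∈ timeInterval T, K ΦF < dEta (Q τ) 1

/-- A steady state: a profile that, kept constant in time, is a global classical solution. -/
def IsSteadyState (K : ℝ → ℝ) (ΦF : ℝ) (q : ℝ → ℝ) : Prop :=
  ∃ N : ℝ, IsClassicalSolution K ΦF q ⊤ (fun _ => q) (fun _ => N)

/-- `(Q, N)` is the maximal classical solution with initial data `Qinit`, and the finite time
`τstar` is its maximal existence time and the first blow-up time of the firing rate `N`:
`(Q, N)` is a classical solution on `[0, τstar)`, every classical solution with the same initial
data is a restriction of it, and `N(τ) → +∞` as `τ` increases to `τstar`. -/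
structure BlowsUpAt (K : ℝ → ℝ) (ΦF : ℝ) (Qinit : ℝ → ℝ) (τstar : ℝ)
    (Q : ℝ → ℝ → ℝ) (N : ℝ → ℝ) : Prop where
  solution : IsClassicalSolution K ΦF Qinit (τstar : EReal) Q N
  maximal : ∀ (T : EReal) (Q₁ : ℝ → ℝ → ℝ) (N₁ : ℝ → ℝ),
    IsClassicalSolution K ΦF Qinit T Q₁ N₁ →
      T ≤ (τstar : EReal) ∧
        ∀ τ ∈ timeInterval T, N₁ τ = N τ ∧ EqOn (Q₁ τ) (Q τ) (Icc 0 1)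
  blowup : Tendsto N (𝓝[<] τstar) atTop

/-! Write `s = 1/N`. The problem is relaxed by letting `s` take any sign. With `S` the integral of
`s`, the quantity `y = Q - S` obeys `y' = K (y + S)` along each characteristic `η - τ = const`,
which crosses `[0, 1]` in one unit of time. Requiring every characteristic to arrive at `η = 1` with
phase `ΦF` is a renewal equation for `S`. It is a contraction in an exponentially weighted norm
(`exists_renewal`), and compatibility of the data makes its solution `C¹` for all time
(`exists_isRelaxedSolution`). The same contraction shows that a classical solution agrees with the
relaxed one as long as it exists (`input_eq`, `eqOn_relaxed`). Hence the maximal classical solution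
is the relaxed one up to the first zero of `s`, and there `N = 1/s` blows up
(`IsRelaxedSolution.blowsUpAt`).

It remains to bound that zero. Let `p = ∂_η Q`; it satisfies `p' = K'(Q) p` along characteristics,
and `p(τ,1) - p(τ,0) = K(ΦF) - K(0)`. The difference `w = p₁ - p₂` of two solutions is therefore
transported on a circle, and the right growth rate of `∫ |w|` is at least `∫ sign(w) (K'(Q₁) p₁ -
K'(Q₂) p₂)`. On `[0, ΦF]` one has `K' = k_min + A + B` with `A ≥ 0` increasing and `B ≥ 0`
decreasing. The `A` and `B` parts contribute nonnegatively: replacing `sign(w)` by `∓ sign(Q₁ - Q₂)`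
can only decrease the integrand, and the combined replaced integral vanishes because its integrand
is the derivative of an absolute value that is zero at both ends (`kMin_mul_integral_abs_le`). So
the `L¹` distance to the steady state grows at least like `exp(k_min τ)` (`integral_abs_sub_ge`).
While `s ≥ 0`, both derivatives are nonnegative with integral `ΦF`, so this distance is at most `2
ΦF`, which bounds the time.

The steady state solves `g' = c + K(g)` with crossing time `∫ dφ/(c + K(φ)) = 1`. This integral
decreases strictly in `c` and exceeds 1 at `c = 0`, so `c` exists and is unique. -/

/-! ### Contraction in exponentially weighted norms -/

/-- Growth of order at most `exp (l * |t|)` on the real line. -/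
def HasExpGrowth (l : ℝ) (f : ℝ → ℝ) : Prop :=
  ∃ M : ℝ, ∀ t, |f t| ≤ M * Real.exp (l * |t|)

/-- The substitution `f = exp (l * |t|) * u` turns the weighted norm into the sup norm on bounded
continuous functions, where Banach's theorem applies. -/
theorem exists_fixedPoint_of_weighted_contraction (l : ℝ) (F : (ℝ → ℝ) → ℝ → ℝ)
    (hcont : ∀ f, Continuous f → HasExpGrowth l f → Continuous (F f))
    (h0 : HasExpGrowth l (F fun _ => 0))
    (hF : ∀ f g, Continuous f → HasExpGrowth l f → Continuous g → HasExpGrowth l g →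
      ∀ m, (∀ t, |f t - g t| ≤ m * Real.exp (l * |t|)) →
        ∀ t, |F f t - F g t| ≤ m / 2 * Real.exp (l * |t|)) :
    ∃ f, Continuous f ∧ HasExpGrowth l f ∧ F f = f := by
  classical
  let W : BoundedContinuousFunction ℝ ℝ → ℝ → ℝ := fun u t => Real.exp (l * |t|) * u t
  have hWc : ∀ u, Continuous (W u) := fun u => by
    have := u.continuous
    show Continuous fun t => Real.exp (l * |t|) * u t
    fun_prop
  have hWg : ∀ u, HasExpGrowth l (W u) := fun u => ⟨‖u‖, fun t => by
    have h := u.norm_coe_le_norm t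
    rw [Real.norm_eq_abs] at h
    show |Real.exp (l * |t|) * u t| ≤ _
    rw [abs_mul, abs_of_pos (Real.exp_pos _), mul_comm]
    gcongr⟩
  have hzero : HasExpGrowth l fun _ : ℝ => (0 : ℝ) := ⟨0, fun t => by simp⟩
  have hFg : ∀ u, HasExpGrowth l (F (W u)) := fun u => by
    obtain ⟨M, hM⟩ := h0
    obtain ⟨M', hM'⟩ := hWg u
    refine ⟨M + M' / 2, fun t => ?_⟩
    have h1 := hF (W u) (fun _ => 0) (hWc u) (hWg u) continuous_const hzero M'
      (fun t => by simpa using hM' t) t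
    have h2 := hM t
    have h3 : |F (W u) t| ≤ |F (W u) t - F (fun _ => 0) t| + |F (fun _ => 0) t| := by
      have := abs_add_le (F (W u) t - F (fun _ => 0) t) (F (fun _ => 0) t)
      simpa using this
    calc _ ≤ _ := h3
      _ ≤ _ := add_le_add h1 h2
      _ = _ := by ring
  have hexp : ∀ t : ℝ, Real.exp (-(l * |t|)) * Real.exp (l * |t|) = 1 := fun t => by
    rw [← Real.exp_add]; simp
  have hb : ∀ u, ∃ M, ∀ t, ‖Real.exp (-(l * |t|)) * F (W u) t‖ ≤ M := fun u => by
    obtain ⟨M, hM⟩ := hFg u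
    refine ⟨M, fun t => ?_⟩
    rw [Real.norm_eq_abs, abs_mul, abs_of_pos (Real.exp_pos _)]
    calc _ ≤ Real.exp (-(l * |t|)) * (M * Real.exp (l * |t|)) := by gcongr; exact hM t
      _ = M * (Real.exp (-(l * |t|)) * Real.exp (l * |t|)) := by ring
      _ = M := by rw [hexp, mul_one]
  have hcc : ∀ u, Continuous fun t => Real.exp (-(l * |t|)) * F (W u) t := fun u => by
    have := hcont _ (hWc u) (hWg u)
    fun_prop
  let Φ : BoundedContinuousFunction ℝ ℝ → BoundedContinuousFunction ℝ ℝ := fun u =>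
    BoundedContinuousFunction.ofNormedAddCommGroup _ (hcc u) (hb u).choose (hb u).choose_spec
  have hΦ : ∀ u t, Φ u t = Real.exp (-(l * |t|)) * F (W u) t := fun u t => rfl
  have hc : ContractingWith (1 / 2) Φ := by
    refine ⟨by norm_num, LipschitzWith.of_dist_le_mul fun u v => ?_⟩
    rw [BoundedContinuousFunction.dist_le (by positivity)]
    intro t
    have h1 := hF (W u) (W v) (hWc u) (hWg u) (hWc v) (hWg v) (dist u v) (fun t => by
      show |Real.exp (l * |t|) * u t - Real.exp (l * |t|) * v t| ≤ _
      rw [← mul_sub, abs_mul, abs_of_pos (Real.exp_pos _), mul_comm, ← Real.dist_eq]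
      gcongr
      exact BoundedContinuousFunction.dist_coe_le_dist t) t
    rw [hΦ, hΦ, Real.dist_eq, ← mul_sub, abs_mul, abs_of_pos (Real.exp_pos _)]
    calc _ ≤ Real.exp (-(l * |t|)) * (dist u v / 2 * Real.exp (l * |t|)) := by gcongr
      _ = dist u v / 2 * (Real.exp (-(l * |t|)) * Real.exp (l * |t|)) := by ring
      _ = dist u v / 2 := by rw [hexp, mul_one]
      _ = _ := by push_cast; ring
  obtain ⟨u, hu⟩ : ∃ u, Φ u = u := ⟨_, hc.fixedPoint_isFixedPt⟩
  refine ⟨W u, hWc u, hWg u, funext fun t => ?_⟩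
  have h1 : Real.exp (-(l * |t|)) * F (W u) t = u t := by rw [← hΦ, hu]
  show _ = Real.exp (l * |t|) * u t
  rw [← h1, ← mul_assoc, mul_comm (Real.exp (l * |t|)), hexp, one_mul]

/-- Integration gains a factor `1 / l` in the weighted norm, so a large `l` makes integral operators
contract on the whole line. -/
theorem abs_integral_exp_mul_abs_le {l m : ℝ} (hl : 0 < l) (hm : 0 ≤ m) {f : ℝ → ℝ}
    (hf : ∀ t, |f t| ≤ m * Real.exp (l * |t|)) (t : ℝ) :
    |∫ r in (0 : ℝ)..t, f r| ≤ m / l * Real.exp (l * |t|) := by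
  have key : ∀ (g : ℝ → ℝ), (∀ t, |g t| ≤ m * Real.exp (l * |t|)) → ∀ t, 0 ≤ t →
      |∫ r in (0 : ℝ)..t, g r| ≤ m / l * Real.exp (l * |t|) := by
    intro g hg t ht
    have hd : ∀ r ∈ uIcc 0 t, HasDerivAt (fun r => m / l * Real.exp (l * r))
        (m * Real.exp (l * r)) r := fun r _ => by
      have := (((hasDerivAt_id r).const_mul l).exp).const_mul (m / l)
      refine this.congr_deriv ?_
      simp only [id]
      field_simp
    have hi : IntervalIntegrable (fun r => m * Real.exp (l * r)) MeasureTheory.volume 0 t :=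
      (by fun_prop : Continuous fun r => m * Real.exp (l * r)).intervalIntegrable _ _
    have h1 := intervalIntegral.integral_eq_sub_of_hasDerivAt hd hi
    have h2 : ‖∫ r in (0 : ℝ)..t, g r‖ ≤ ∫ r in (0 : ℝ)..t, m * Real.exp (l * r) := by
      refine intervalIntegral.norm_integral_le_of_norm_le ht ?_ hi
      refine Eventually.of_forall fun r hr => ?_
      have := hg r
      rwa [abs_of_pos hr.1] at this
    rw [h1, Real.norm_eq_abs] at h2
    rw [abs_of_nonneg ht]
    have : 0 ≤ m / l * Real.exp (l * 0) := by positivity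
    linarith
  rcases le_total 0 t with ht | ht
  · exact key f hf t ht
  · have h1 := key (fun r => f (-r)) (fun r => by simpa using hf (-r)) (-t) (by linarith)
    rw [intervalIntegral.integral_comp_neg] at h1
    rw [intervalIntegral.integral_symm, abs_neg]
    simpa using h1

/-! ### The flow of the phase equation and its inverse -/

theorem abs_sub_le_of_abs_deriv_le {K : ℝ → ℝ} {C : ℝ} (hK : Differentiable ℝ K)
    (hC : ∀ x, |deriv K x| ≤ C) (x y : ℝ) : |K x - K y| ≤ C * |x - y| :=
  Convex.norm_image_sub_le_of_norm_deriv_le (fun z _ => hK z) (fun z _ => hC z) convex_univ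
    (mem_univ y) (mem_univ x)

/-- Global flow of `y' = K (y + S t)`, started at time `0`. -/
theorem exists_flow {K : ℝ → ℝ} {C l : ℝ} (hK : Differentiable ℝ K) (hC : ∀ x, |deriv K x| ≤ C)
    (hl : 0 < l) (hCl : 2 * C ≤ l) {S : ℝ → ℝ} (hS : Continuous S) (hSg : HasExpGrowth l S) :
    ∃ Y : ℝ → ℝ → ℝ, (∀ α, Y 0 α = α) ∧
      ∀ t α, HasDerivAt (fun r => Y r α) (K (Y t α + S t)) t := by
  have hC0 : 0 ≤ C := (abs_nonneg _).trans (hC 0)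
  have hKc := hK.continuous
  have hex : ∀ α, ∃ y : ℝ → ℝ, Continuous y ∧ HasExpGrowth l y ∧
      (fun t => α + ∫ r in (0 : ℝ)..t, K (y r + S r)) = y := by
    intro α
    -- Picard's integral equation; its Lipschitz constant in the weighted norm is `C / l`, at most
    -- `1 / 2` by `hCl`.
    refine exists_fixedPoint_of_weighted_contraction l
      (fun y t => α + ∫ r in (0 : ℝ)..t, K (y r + S r)) ?_ ?_ ?_
    · intro f hf _
      have : Continuous fun r => K (f r + S r) := by fun_prop
      exact continuous_const.add (intervalIntegral.continuous_primitive
        (fun a b => this.intervalIntegrable a b) 0)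
    · obtain ⟨M, hM⟩ := hSg
      have hM0 : 0 ≤ M := by simpa using (abs_nonneg _).trans (hM 0)
      refine ⟨|α| + (|K 0| + C * M) / l, fun t => ?_⟩
      have h1 := abs_integral_exp_mul_abs_le (l := l) (m := |K 0| + C * M) hl (by positivity)
        (f := fun r => K (0 + S r)) (fun r => by
          have h2 := abs_sub_le_of_abs_deriv_le hK hC (0 + S r) 0
          have h3 : |K (0 + S r)| ≤ |K (0 + S r) - K 0| + |K 0| := by
            simpa using abs_add_le (K (0 + S r) - K 0) (K 0)
          have h4 : 1 ≤ Real.exp (l * |r|) := Real.one_le_exp (by positivity)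
          have h5 := hM r
          simp only [zero_add, sub_zero] at h2 h3 ⊢
          have h6 : C * |S r| ≤ C * (M * Real.exp (l * |r|)) := by gcongr
          have h7 : |K 0| * 1 ≤ |K 0| * Real.exp (l * |r|) := by gcongr
          linarith) t
      have h4 : 1 ≤ Real.exp (l * |t|) := Real.one_le_exp (by positivity)
      have h7 : |α| * 1 ≤ |α| * Real.exp (l * |t|) := by gcongr
      refine (abs_add_le _ _).trans ?_
      rw [add_mul]
      linarith
    · intro f g hf _ hg _ m hm t
      have hm0 : 0 ≤ m := by simpa using (abs_nonneg _).trans (hm 0)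
      have hfi : Continuous fun r => K (f r + S r) := by fun_prop
      have hgi : Continuous fun r => K (g r + S r) := by fun_prop
      have : (α + ∫ r in (0 : ℝ)..t, K (f r + S r)) - (α + ∫ r in (0 : ℝ)..t, K (g r + S r)) =
          ∫ r in (0 : ℝ)..t, (K (f r + S r) - K (g r + S r)) := by
        rw [intervalIntegral.integral_sub (hfi.intervalIntegrable _ _)
          (hgi.intervalIntegrable _ _)]
        ring
      rw [this]
      refine (abs_integral_exp_mul_abs_le (m := C * m) hl (by positivity) (fun r => ?_) t).trans ?_
      · have h2 := abs_sub_le_of_abs_deriv_le hK hC (f r + S r) (g r + S r)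
        rw [add_sub_add_right_eq_sub] at h2
        refine h2.trans ?_
        rw [mul_assoc]
        gcongr
        exact hm r
      · refine mul_le_mul_of_nonneg_right ?_ (Real.exp_pos _).le
        rw [div_le_div_iff₀ hl two_pos]
        nlinarith
  choose Y hYc _ hY using hex
  refine ⟨fun t α => Y α t, fun α => ?_, fun t α => ?_⟩
  · have := congrFun (hY α) 0
    simpa using this.symm
  · have hcY := hYc α
    have hi : Continuous fun r => K (Y α r + S r) := by fun_prop
    have := (intervalIntegral.integral_hasDerivAt_right (hi.intervalIntegrable 0 t)
      hi.stronglyMeasurable.stronglyMeasurableAtFilter hi.continuousAt).const_add α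
    simp only [hY α] at this
    exact this

/-- The divided difference of `K`, as the mean of the derivative. -/
noncomputable def meanSlope (K : ℝ → ℝ) (u v : ℝ) : ℝ :=
  ∫ θ in (0 : ℝ)..1, deriv K (u + θ * (v - u))

theorem continuous_meanSlope {K : ℝ → ℝ} (hK : ContDiff ℝ 1 K) :
    Continuous fun p : ℝ × ℝ => meanSlope K p.1 p.2 := by
  have hK' : Continuous (deriv K) := hK.continuous_deriv le_rfl
  unfold meanSlope
  apply intervalIntegral.continuous_parametric_intervalIntegral_of_continuous'
  fun_prop

theorem sub_eq_meanSlope_mul {K : ℝ → ℝ} (hK : ContDiff ℝ 1 K) (u v : ℝ) :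
    K v - K u = meanSlope K u v * (v - u) := by
  have hK' : Continuous (deriv K) := hK.continuous_deriv le_rfl
  have hd : ∀ θ ∈ uIcc (0 : ℝ) 1, HasDerivAt (fun θ => K (u + θ * (v - u)))
      (deriv K (u + θ * (v - u)) * (v - u)) θ := fun θ _ => by
    have h1 : HasDerivAt (fun θ => u + θ * (v - u)) (v - u) θ := by
      simpa using ((hasDerivAt_id θ).mul_const (v - u)).const_add u
    exact ((hK.differentiable one_ne_zero _).hasDerivAt).comp θ h1
  have := intervalIntegral.integral_eq_sub_of_hasDerivAt hd
    ((by fun_prop : Continuous fun θ => deriv K (u + θ * (v - u)) * (v - u)).intervalIntegrable _ _)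
  rw [intervalIntegral.integral_mul_const] at this
  simp only [one_mul, zero_mul, add_zero, add_sub_cancel] at this
  exact this.symm

theorem meanSlope_self (K : ℝ → ℝ) (u : ℝ) : meanSlope K u u = deriv K u := by
  simp [meanSlope]

theorem abs_meanSlope_le {K : ℝ → ℝ} {C : ℝ} (hC : ∀ x, |deriv K x| ≤ C) (u v : ℝ) :
    |meanSlope K u v| ≤ C := by
  have := intervalIntegral.norm_integral_le_of_norm_le_const (a := (0 : ℝ)) (b := 1)
    (f := fun θ => deriv K (u + θ * (v - u))) (C := C) (fun θ _ => hC _)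
  simpa [meanSlope] using this

/-- `Y` is the flow, started at time `0`, of `y' = K (y + S t)`. -/
structure IsFlow (K S : ℝ → ℝ) (Y : ℝ → ℝ → ℝ) : Prop where
  zero : ∀ α, Y 0 α = α
  hasDerivAt : ∀ t α, HasDerivAt (fun r => Y r α) (K (Y t α + S t)) t

/-- The derivative of the flow with respect to the initial value. -/
noncomputable def flowDeriv (K S : ℝ → ℝ) (Y : ℝ → ℝ → ℝ) (t α : ℝ) : ℝ :=
  Real.exp (∫ r in (0 : ℝ)..t, deriv K (Y r α + S r))

namespace IsFlow

variable {K S : ℝ → ℝ} {Y : ℝ → ℝ → ℝ} {C : ℝ}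

theorem continuous_left (h : IsFlow K S Y) (α : ℝ) : Continuous fun t => Y t α :=
  continuous_iff_continuousAt.2 fun t => (h.hasDerivAt t α).continuousAt

/-- The difference of two trajectories solves a linear equation whose coefficient is the divided
difference of `K`. This exact formula yields the two-sided Lipschitz bounds, monotonicity and
differentiability in the initial value. -/
theorem sub_eq (h : IsFlow K S Y) (hK : ContDiff ℝ 1 K) (hS : Continuous S) (t α β : ℝ) :
    Y t α - Y t β =
      (α - β) * Real.exp (∫ r in (0 : ℝ)..t, meanSlope K (Y r β + S r) (Y r α + S r)) := by
  set M : ℝ → ℝ := fun r => meanSlope K (Y r β + S r) (Y r α + S r) with hM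
  have hMc : Continuous M :=
    (continuous_meanSlope hK).comp (((h.continuous_left β).add hS).prodMk
      ((h.continuous_left α).add hS))
  set G : ℝ → ℝ := fun t => ∫ r in (0 : ℝ)..t, M r with hG
  have hGd : ∀ t, HasDerivAt G (M t) t := fun t =>
    intervalIntegral.integral_hasDerivAt_right (hMc.intervalIntegrable 0 t)
      hMc.stronglyMeasurable.stronglyMeasurableAtFilter hMc.continuousAt
  have hd : ∀ t, HasDerivAt (fun t => (Y t α - Y t β) * Real.exp (-G t)) 0 t := fun t => by
    have h1 := ((h.hasDerivAt t α).sub (h.hasDerivAt t β)).mul ((hGd t).neg.exp)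
    refine h1.congr_deriv ?_
    have h2 := sub_eq_meanSlope_mul hK (Y t β + S t) (Y t α + S t)
    simp only [Pi.sub_apply]
    rw [h2]
    simp only [hM]
    ring
  have hconst := is_const_of_deriv_eq_zero (fun t => (hd t).differentiableAt)
    (fun t => (hd t).deriv) t 0
  have hG0 : G 0 = 0 := by simp [hG]
  beta_reduce at hconst
  rw [hG0, neg_zero, Real.exp_zero, mul_one, h.zero, h.zero] at hconst
  rw [← hconst, mul_assoc, ← Real.exp_add, show -G t + intervalIntegral M 0 t _ = 0 from
    neg_add_cancel (G t), Real.exp_zero, mul_one]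

theorem abs_integral_meanSlope_le (hC : ∀ x, |deriv K x| ≤ C) (f g : ℝ → ℝ) (t : ℝ) :
    |∫ r in (0 : ℝ)..t, meanSlope K (f r) (g r)| ≤ C * |t| := by
  have := intervalIntegral.norm_integral_le_of_norm_le_const (a := (0 : ℝ)) (b := t)
    (f := fun r => meanSlope K (f r) (g r)) (C := C) (fun θ _ => abs_meanSlope_le hC _ _)
  simpa using this

theorem abs_sub_le (h : IsFlow K S Y) (hK : ContDiff ℝ 1 K) (hS : Continuous S)
    (hC : ∀ x, |deriv K x| ≤ C) (t α β : ℝ) :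
    |Y t α - Y t β| ≤ Real.exp (C * |t|) * |α - β| := by
  rw [h.sub_eq hK hS, abs_mul, mul_comm, abs_of_pos (Real.exp_pos _)]
  gcongr
  exact (le_abs_self _).trans (abs_integral_meanSlope_le hC _ _ t)

theorem le_abs_sub (h : IsFlow K S Y) (hK : ContDiff ℝ 1 K) (hS : Continuous S)
    (hC : ∀ x, |deriv K x| ≤ C) (t α β : ℝ) :
    Real.exp (-(C * |t|)) * |α - β| ≤ |Y t α - Y t β| := by
  rw [h.sub_eq hK hS, abs_mul, mul_comm |α - β|, abs_of_pos (Real.exp_pos _)]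
  gcongr
  exact neg_le_of_abs_le (abs_integral_meanSlope_le hC _ _ t)

theorem continuous_uncurry (h : IsFlow K S Y) (hK : ContDiff ℝ 1 K) (hS : Continuous S)
    (hC : ∀ x, |deriv K x| ≤ C) : Continuous fun p : ℝ × ℝ => Y p.1 p.2 := by
  rw [continuous_iff_continuousAt]
  rintro ⟨t, α⟩
  have h1 : Tendsto (fun p : ℝ × ℝ => Y p.1 p.2 - Y p.1 α) (𝓝 (t, α)) (𝓝 0) := by
    refine squeeze_zero_norm (fun p => h.abs_sub_le hK hS hC p.1 p.2 α) ?_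
    have : Continuous fun p : ℝ × ℝ => Real.exp (C * |p.1|) * |p.2 - α| := by fun_prop
    simpa using this.tendsto (t, α)
  have h2 : Tendsto (fun p : ℝ × ℝ => Y p.1 α) (𝓝 (t, α)) (𝓝 (Y t α)) :=
    ((h.continuous_left α).comp continuous_fst).tendsto (t, α)
  simpa [ContinuousAt] using h1.add h2

theorem hasDerivAt_flowDeriv (h : IsFlow K S Y) (hK : ContDiff ℝ 1 K) (hS : Continuous S)
    (t α : ℝ) : HasDerivAt (fun r => flowDeriv K S Y r α)
      (deriv K (Y t α + S t) * flowDeriv K S Y t α) t := by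
  have hK' : Continuous (deriv K) := hK.continuous_deriv le_rfl
  have hY := h.continuous_left α
  have hMc : Continuous fun r => deriv K (Y r α + S r) := by fun_prop
  have := (intervalIntegral.integral_hasDerivAt_right (hMc.intervalIntegrable 0 t)
      hMc.stronglyMeasurable.stronglyMeasurableAtFilter hMc.continuousAt).exp
  refine this.congr_deriv ?_
  rw [mul_comm]; rfl

theorem continuous_flowDeriv (h : IsFlow K S Y) (hK : ContDiff ℝ 1 K) (hS : Continuous S)
    (hC : ∀ x, |deriv K x| ≤ C) : Continuous fun p : ℝ × ℝ => flowDeriv K S Y p.1 p.2 := by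
  have hK' : Continuous (deriv K) := hK.continuous_deriv le_rfl
  have hY := h.continuous_uncurry hK hS hC
  unfold flowDeriv
  refine Real.continuous_exp.comp ?_
  refine intervalIntegral.continuous_parametric_intervalIntegral_of_continuous
    (f := fun (p : ℝ × ℝ) r => deriv K (Y r p.2 + S r)) ?_ continuous_fst
  have : Continuous fun q : (ℝ × ℝ) × ℝ => Y q.2 q.1.2 :=
    hY.comp (continuous_snd.prodMk (continuous_snd.comp continuous_fst))
  show Continuous fun q : (ℝ × ℝ) × ℝ => deriv K (Y q.2 q.1.2 + S q.2)
  fun_prop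

/-- By `sub_eq` the difference quotient is an exponential depending continuously on `α`, and at `α =
β` the divided difference of `K` becomes its derivative. -/
theorem hasDerivAt_right (h : IsFlow K S Y) (hK : ContDiff ℝ 1 K) (hS : Continuous S)
    (hC : ∀ x, |deriv K x| ≤ C) (t β : ℝ) :
    HasDerivAt (fun α => Y t α) (flowDeriv K S Y t β) β := by
  have hY := h.continuous_uncurry hK hS hC
  have hE : Continuous fun α => Real.exp
      (∫ r in (0 : ℝ)..t, meanSlope K (Y r β + S r) (Y r α + S r)) := by
    refine Real.continuous_exp.comp ?_
    refine intervalIntegral.continuous_parametric_intervalIntegral_of_continuous'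
      (f := fun α r => meanSlope K (Y r β + S r) (Y r α + S r)) ?_ 0 t
    have h1 : Continuous fun q : ℝ × ℝ => Y q.2 q.1 := hY.comp continuous_swap
    have h2 : Continuous fun q : ℝ × ℝ => Y q.2 β :=
      (h.continuous_left β).comp continuous_snd
    exact (continuous_meanSlope hK).comp ((h2.add (hS.comp continuous_snd)).prodMk
      (h1.add (hS.comp continuous_snd)))
  rw [hasDerivAt_iff_tendsto_slope]
  have h0 : Real.exp (∫ r in (0 : ℝ)..t, meanSlope K (Y r β + S r) (Y r β + S r)) =
      flowDeriv K S Y t β := by simp only [meanSlope_self, flowDeriv]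
  rw [← h0]
  refine ((hE.tendsto β).mono_left nhdsWithin_le_nhds).congr' ?_
  filter_upwards [self_mem_nhdsWithin] with α hα
  have : α - β ≠ 0 := sub_ne_zero.2 hα
  rw [slope_def_field, h.sub_eq hK hS]
  field_simp

theorem hasStrictFDerivAt (h : IsFlow K S Y) (hK : ContDiff ℝ 1 K) (hS : Continuous S)
    (hC : ∀ x, |deriv K x| ≤ C) (p : ℝ × ℝ) :
    HasStrictFDerivAt (fun p : ℝ × ℝ => Y p.1 p.2)
      (((ContinuousLinearMap.toSpanSingleton ℝ (K (Y p.1 p.2 + S p.1)))).coprod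
        (ContinuousLinearMap.toSpanSingleton ℝ (flowDeriv K S Y p.1 p.2))) p := by
  have hY := h.continuous_uncurry hK hS hC
  have hF := h.continuous_flowDeriv hK hS hC
  have hKc := hK.continuous
  have hl : Continuous fun x : ℝ => ContinuousLinearMap.toSpanSingleton ℝ x :=
    (ContinuousLinearMap.toSpanSingletonCLE (𝕜 := ℝ) (E := ℝ)).continuous
  refine hasStrictFDerivAt_uncurry_coprod (u := p) (f := Y)
    (f₁ := fun t α => ContinuousLinearMap.toSpanSingleton ℝ (K (Y t α + S t)))
    (f₂ := fun t α => ContinuousLinearMap.toSpanSingleton ℝ (flowDeriv K S Y t α))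
    (Eventually.of_forall fun q => (h.hasDerivAt q.1 q.2).hasFDerivAt)
    (Eventually.of_forall fun q => (h.hasDerivAt_right hK hS hC q.1 q.2).hasFDerivAt) ?_ ?_
  · refine (hl.comp (?_ : Continuous fun q : ℝ × ℝ => K (Y q.1 q.2 + S q.1))).continuousAt
    fun_prop
  · exact (hl.comp hF).continuousAt

theorem contDiff (h : IsFlow K S Y) (hK : ContDiff ℝ 1 K) (hS : Continuous S)
    (hC : ∀ x, |deriv K x| ≤ C) : ContDiff ℝ 1 fun p : ℝ × ℝ => Y p.1 p.2 := by
  have hY := h.continuous_uncurry hK hS hC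
  have hF := h.continuous_flowDeriv hK hS hC
  have hKc := hK.continuous
  have hl : Continuous fun x : ℝ => ContinuousLinearMap.toSpanSingleton ℝ x :=
    (ContinuousLinearMap.toSpanSingletonCLE (𝕜 := ℝ) (E := ℝ)).continuous
  rw [contDiff_one_iff_hasFDerivAt]
  refine ⟨_, ?_, fun p => (h.hasStrictFDerivAt hK hS hC p).hasFDerivAt⟩
  have h1 : Continuous fun q : ℝ × ℝ => K (Y q.1 q.2 + S q.1) := by fun_prop
  have h2 : ∀ q : ℝ × ℝ, ((ContinuousLinearMap.toSpanSingleton ℝ (K (Y q.1 q.2 + S q.1)))).coprod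
        (ContinuousLinearMap.toSpanSingleton ℝ (flowDeriv K S Y q.1 q.2)) =
      K (Y q.1 q.2 + S q.1) • ContinuousLinearMap.fst ℝ ℝ ℝ +
        flowDeriv K S Y q.1 q.2 • ContinuousLinearMap.snd ℝ ℝ ℝ := fun q => by
    ext <;> simp
  simp only [h2]
  exact (h1.smul continuous_const).add (hF.smul continuous_const)

/-- `Y t` is increasing with difference quotients at least `exp (-(C * |t|))`, so it is unbounded in
both directions. -/
theorem surjective (h : IsFlow K S Y) (hK : ContDiff ℝ 1 K) (hS : Continuous S)
    (hC : ∀ x, |deriv K x| ≤ C) (t : ℝ) : Function.Surjective (Y t) := by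
  have hc : Continuous (Y t) := (h.continuous_uncurry hK hS hC).comp (by fun_prop : Continuous
    fun α : ℝ => (t, α))
  have hm : StrictMono (Y t) := by
    intro α β hαβ
    have := h.sub_eq hK hS t β α
    have h2 : 0 < (β - α) * Real.exp
        (∫ r in (0 : ℝ)..t, meanSlope K (Y r α + S r) (Y r β + S r)) :=
      mul_pos (sub_pos.2 hαβ) (Real.exp_pos _)
    linarith
  have he := Real.exp_pos (-(C * |t|))
  refine hc.surjective ?_ ?_
  · have h1 : Tendsto (fun α => Y t 0 + Real.exp (-(C * |t|)) * α) atTop atTop :=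
      tendsto_atTop_add_const_left _ _ (tendsto_id.const_mul_atTop he)
    refine tendsto_atTop_mono' _ ?_ h1
    filter_upwards [eventually_ge_atTop 0] with α hα
    have h2 := h.le_abs_sub hK hS hC t α 0
    rw [sub_zero, abs_of_nonneg hα, abs_of_nonneg (sub_nonneg.2 (hm.monotone hα))] at h2
    linarith
  · have h1 : Tendsto (fun α => Y t 0 + Real.exp (-(C * |t|)) * α) atBot atBot :=
      tendsto_atBot_add_const_left _ _ (tendsto_id.const_mul_atBot he)
    refine tendsto_atBot_mono' _ ?_ h1
    filter_upwards [eventually_le_atBot 0] with α hα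
    have h2 := h.le_abs_sub hK hS hC t α 0
    rw [sub_zero, abs_of_nonpos hα, abs_of_nonpos (sub_nonpos.2 (hm.monotone hα))] at h2
    linarith

/-- The inverse of the flow: `Z t β` is the initial value of the trajectory through `β` at time
`t`. -/
theorem exists_inverse (h : IsFlow K S Y) (hK : ContDiff ℝ 1 K) (hS : Continuous S)
    (hC : ∀ x, |deriv K x| ≤ C) :
    ∃ Z : ℝ → ℝ → ℝ, (∀ t β, Y t (Z t β) = β) ∧ (∀ t α, Z t (Y t α) = α) ∧
      ContDiff ℝ 1 fun p : ℝ × ℝ => Z p.1 p.2 := by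
  choose Z hZ using h.surjective hK hS hC
  have hZ' : ∀ t α, Z t (Y t α) = α := fun t α => by
    have h1 := h.le_abs_sub hK hS hC t (Z t (Y t α)) α
    rw [hZ, sub_self, abs_zero] at h1
    have h2 : |Z t (Y t α) - α| ≤ 0 := nonpos_of_mul_nonpos_right h1 (Real.exp_pos _)
    exact sub_eq_zero.1 (abs_nonpos_iff.1 h2)
  refine ⟨Z, hZ, hZ', ?_⟩
  have hYc := h.continuous_uncurry hK hS hC
  have hZc : Continuous fun p : ℝ × ℝ => Z p.1 p.2 := by
    rw [continuous_iff_continuousAt]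
    rintro ⟨t, β⟩
    have h1 : Tendsto (fun p : ℝ × ℝ => Z p.1 p.2 - Z t β) (𝓝 (t, β)) (𝓝 0) := by
      refine squeeze_zero_norm (a := fun p : ℝ × ℝ =>
        Real.exp (C * |p.1|) * |p.2 - Y p.1 (Z t β)|) (fun p => ?_) ?_
      · have h2 := h.le_abs_sub hK hS hC p.1 (Z p.1 p.2) (Z t β)
        rw [hZ, Real.exp_neg, inv_mul_le_iff₀ (Real.exp_pos _)] at h2
        exact h2
      · have : Continuous fun p : ℝ × ℝ => Real.exp (C * |p.1|) * |p.2 - Y p.1 (Z t β)| := by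
          have := (h.continuous_left (Z t β)).comp (continuous_fst (X := ℝ) (Y := ℝ))
          simp only [Function.comp_def] at this
          fun_prop
        simpa [hZ] using this.tendsto (t, β)
    have := h1.add_const (Z t β)
    simpa [ContinuousAt] using this
  -- Adjoining time gives a homeomorphism of the plane with triangular derivative, invertible
  -- because `flowDeriv` never vanishes; the inverse is then `C¹`.
  let e : ℝ × ℝ ≃ₜ ℝ × ℝ :=
    { toFun := fun p => (p.1, Y p.1 p.2)
      invFun := fun p => (p.1, Z p.1 p.2)
      left_inv := fun p => by simp [hZ']
      right_inv := fun p => by simp [hZ]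
      continuous_toFun := by fun_prop
      continuous_invFun := by fun_prop }
  have he : ContDiff ℝ 1 e := contDiff_fst.prodMk (h.contDiff hK hS hC)
  let L : ℝ → ℝ → (ℝ × ℝ →L[ℝ] ℝ × ℝ) := fun c d =>
    (ContinuousLinearMap.fst ℝ ℝ ℝ).prod
      (c • ContinuousLinearMap.fst ℝ ℝ ℝ + d • ContinuousLinearMap.snd ℝ ℝ ℝ)
  have hL : ∀ c d, d ≠ 0 → Function.LeftInverse (L (-c / d) d⁻¹) (L c d) ∧
      Function.RightInverse (L (-c / d) d⁻¹) (L c d) := fun c d hd => by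
    constructor
    · rintro ⟨x, y⟩
      simp only [L, ContinuousLinearMap.prod_apply, add_apply,
        smul_apply, ContinuousLinearMap.coe_fst', ContinuousLinearMap.coe_snd',
        smul_eq_mul, Prod.mk.injEq, true_and]
      field_simp; ring
    · rintro ⟨x, y⟩
      simp only [L, ContinuousLinearMap.prod_apply, add_apply,
        smul_apply, ContinuousLinearMap.coe_fst', ContinuousLinearMap.coe_snd',
        smul_eq_mul, Prod.mk.injEq, true_and]
      field_simp; ring
  have hd : ∀ p : ℝ × ℝ, flowDeriv K S Y p.1 p.2 ≠ 0 := fun p => (Real.exp_pos _).ne'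
  have hsymm : ContDiff ℝ 1 e.symm := by
    refine e.contDiff_symm (f₀' := fun p => ContinuousLinearEquiv.equivOfInverse
      (L (K (Y p.1 p.2 + S p.1)) (flowDeriv K S Y p.1 p.2)) _
      (hL _ _ (hd p)).1 (hL _ _ (hd p)).2) (fun p => ?_) he
    refine (hasFDerivAt_fst.prodMk (h.hasStrictFDerivAt hK hS hC p).hasFDerivAt).congr_fderiv ?_
    ext <;> simp [L]
  exact contDiff_snd.comp hsymm

end IsFlow

/-! ### Comparison of trajectories and the renewal equation -/

theorem abs_sub_le_of_trajectories {K : ℝ → ℝ} {C l b m t₀ τ : ℝ} {y₁ y₂ S₁ S₂ : ℝ → ℝ}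
    (hC : ∀ x y, |K x - K y| ≤ C * |x - y|) (hC0 : 0 ≤ C) (hl : C < l) (ht : t₀ ≤ τ)
    (hc₁ : ContinuousOn y₁ (Icc t₀ τ)) (hc₂ : ContinuousOn y₂ (Icc t₀ τ))
    (hd₁ : ∀ r ∈ Ico t₀ τ, HasDerivWithinAt y₁ (K (y₁ r + S₁ r)) (Ici r) r)
    (hd₂ : ∀ r ∈ Ico t₀ τ, HasDerivWithinAt y₂ (K (y₂ r + S₂ r)) (Ici r) r)
    (hS : ∀ r ∈ Icc t₀ τ, |S₁ r - S₂ r| ≤ m * Real.exp (l * r)) (hm : 0 ≤ m)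
    (hb : |y₁ t₀ - y₂ t₀| ≤ b) :
    |y₁ τ - y₂ τ| ≤ b * Real.exp (C * (τ - t₀)) + C * m / (l - C) * Real.exp (l * τ) := by
  have hlC : 0 < l - C := sub_pos.2 hl
  have key : ∀ ε > 0, |y₁ τ - y₂ τ| ≤
      b * Real.exp (C * (τ - t₀)) + (C * m + ε) / (l - C) * Real.exp (l * τ) := by
    intro ε hε
    -- The barrier solves `B' = C * B + (C * m + ε) * exp (l * r)`; the `ε` supplies the strict
    -- inequality at contact and is removed at the end.
    have := image_norm_le_of_norm_deriv_right_lt_deriv_boundary (E := ℝ) (a := t₀) (b := τ)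
      (f := fun r => y₁ r - y₂ r) (f' := fun r => K (y₁ r + S₁ r) - K (y₂ r + S₂ r))
      (hc₁.sub hc₂) (fun r hr => (hd₁ r hr).sub (hd₂ r hr))
      (B := fun r => b * Real.exp (C * (r - t₀)) + (C * m + ε) / (l - C) * Real.exp (l * r))
      (B' := fun r => C * (b * Real.exp (C * (r - t₀))) +
        l * ((C * m + ε) / (l - C) * Real.exp (l * r))) ?_ ?_ ?_ (right_mem_Icc.2 ht)
    · simpa using this
    · simp only [sub_self, mul_zero, Real.exp_zero, mul_one, Real.norm_eq_abs]
      have : 0 ≤ (C * m + ε) / (l - C) * Real.exp (l * t₀) := by positivity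
      linarith
    · intro r
      have h1 := ((((hasDerivAt_id r).sub_const t₀).const_mul C).exp).const_mul b
      have h2 := (((hasDerivAt_id r).const_mul l).exp).const_mul ((C * m + ε) / (l - C))
      refine (h1.add h2).congr_deriv ?_
      simp only [id]
      ring
    · intro r hr he
      have h1 := hC (y₁ r + S₁ r) (y₂ r + S₂ r)
      have h2 : |y₁ r + S₁ r - (y₂ r + S₂ r)| ≤ |y₁ r - y₂ r| + |S₁ r - S₂ r| := by
        rw [show y₁ r + S₁ r - (y₂ r + S₂ r) = (y₁ r - y₂ r) + (S₁ r - S₂ r) by ring]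
        exact abs_add_le _ _
      have h3 := hS r (Ico_subset_Icc_self hr)
      rw [Real.norm_eq_abs] at he ⊢
      have h4 : C * |y₁ r + S₁ r - (y₂ r + S₂ r)| ≤
          C * (|y₁ r - y₂ r| + m * Real.exp (l * r)) := by gcongr; linarith
      have h5 := Real.exp_pos (l * r)
      have h6 : l * ((C * m + ε) / (l - C) * Real.exp (l * r)) =
          C * ((C * m + ε) / (l - C) * Real.exp (l * r)) + (C * m + ε) * Real.exp (l * r) := by
        field_simp; ring
      have h7 : 0 < ε * Real.exp (l * r) := by positivity
      rw [he] at h4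
      rw [h6]
      nlinarith
  refine le_of_forall_pos_le_add fun δ hδ => ?_
  have h1 := key (δ * (l - C) / Real.exp (l * τ)) (by positivity)
  refine h1.trans (le_of_eq ?_)
  field_simp
  ring

/-- The halving used for both existence and uniqueness of the input. With `l = 9C + 8`, the initial
gap contributes at most `2 * exp (-8) ≤ 2/9` and the input gap `C / (8C + 8) ≤ 1/8`, together less
than `1/2`. -/
theorem abs_sub_le_half_of_trajectories {K : ℝ → ℝ} {C l m t₀ τ : ℝ} {y₁ y₂ S₁ S₂ : ℝ → ℝ}
    (hC : ∀ x y, |K x - K y| ≤ C * |x - y|) (hC0 : 0 ≤ C) (hl : l = 9 * C + 8) (ht : t₀ ≤ τ)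
    (ht1 : τ - t₀ ≤ 1)
    (hc₁ : ContinuousOn y₁ (Icc t₀ τ)) (hc₂ : ContinuousOn y₂ (Icc t₀ τ))
    (hd₁ : ∀ r ∈ Ico t₀ τ, HasDerivWithinAt y₁ (K (y₁ r + S₁ r)) (Ici r) r)
    (hd₂ : ∀ r ∈ Ico t₀ τ, HasDerivWithinAt y₂ (K (y₂ r + S₂ r)) (Ici r) r)
    (hS : ∀ r ∈ Icc t₀ τ, |S₁ r - S₂ r| ≤ m * Real.exp (l * r)) (hm : 0 ≤ m)
    (hb : |y₁ t₀ - y₂ t₀| ≤ 2 * m * Real.exp (l * (τ - 1))) :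
    |y₁ τ - y₂ τ| ≤ m / 2 * Real.exp (l * τ) := by
  have hlC : C < l := by linarith
  have h := abs_sub_le_of_trajectories hC hC0 hlC ht hc₁ hc₂ hd₁ hd₂ hS hm hb
  have h1 : 2 * m * Real.exp (l * (τ - 1)) * Real.exp (C * (τ - t₀)) ≤
      2 * m * (Real.exp (-8) * Real.exp (l * τ)) := by
    rw [mul_assoc (2 * m), ← Real.exp_add, ← Real.exp_add]
    refine mul_le_mul_of_nonneg_left (Real.exp_le_exp.2 ?_) (by positivity)
    nlinarith
  have h2 : Real.exp (-8) ≤ 1 / 9 := by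
    rw [Real.exp_neg, inv_eq_one_div]
    have := Real.add_one_le_exp (8 : ℝ)
    gcongr
    linarith
  have h3 : C * m / (l - C) ≤ m / 8 := by
    rw [div_le_div_iff₀ (by linarith) (by norm_num)]
    nlinarith
  have hE := Real.exp_pos (l * τ)
  have h4 : 2 * m * (Real.exp (-8) * Real.exp (l * τ)) ≤ 2 * m * (1 / 9 * Real.exp (l * τ)) := by
    gcongr
  have h5 : C * m / (l - C) * Real.exp (l * τ) ≤ m / 8 * Real.exp (l * τ) := by gcongr
  have h6 : 0 ≤ m * Real.exp (l * τ) := by positivity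
  linarith

/-- The renewal equation for the accumulated input `S`: the phase reached after a unit of time (or
at time `τ ≤ 1`, starting from the initial profile `q`) is always `ΦF`. -/
theorem exists_renewal {K : ℝ → ℝ} {C ΦF : ℝ} (hK : ContDiff ℝ 1 K) (hC : ∀ x, |deriv K x| ≤ C)
    {q : ℝ → ℝ} (hq : Continuous q) (hq1 : q 1 = ΦF) :
    ∃ (S : ℝ → ℝ) (Y Z : ℝ → ℝ → ℝ), Continuous S ∧ IsFlow K S Y ∧
      (∀ t β, Y t (Z t β) = β) ∧ (∀ t α, Z t (Y t α) = α) ∧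
      (ContDiff ℝ 1 fun p : ℝ × ℝ => Z p.1 p.2) ∧ S 0 = 0 ∧
      ∀ τ, 0 ≤ τ →
        S τ = ΦF - Y τ (Z (max (τ - 1) 0) (q (max (1 - τ) 0) - S (max (τ - 1) 0))) := by
  have hC0 : 0 ≤ C := (abs_nonneg _).trans (hC 0)
  have hKd := hK.differentiable one_ne_zero
  have hLip : ∀ x y, |K x - K y| ≤ C * |x - y| := abs_sub_le_of_abs_deriv_le hKd hC
  obtain ⟨l, hl⟩ : ∃ l, l = 9 * C + 8 := ⟨_, rfl⟩
  have hl0 : 0 < l := by linarith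
  have hex : ∀ S : ℝ → ℝ, ∃ Y Z : ℝ → ℝ → ℝ, Continuous S → HasExpGrowth l S →
      IsFlow K S Y ∧ (∀ t β, Y t (Z t β) = β) ∧ (∀ t α, Z t (Y t α) = α) ∧
      (ContDiff ℝ 1 fun p : ℝ × ℝ => Z p.1 p.2) := by
    intro S
    by_cases h : Continuous S ∧ HasExpGrowth l S
    · obtain ⟨Y, hY0, hY⟩ := exists_flow hKd hC hl0 (by linarith) h.1 h.2
      have hf : IsFlow K S Y := ⟨hY0, hY⟩
      obtain ⟨Z, h1, h2, h3⟩ := hf.exists_inverse hK h.1 hC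
      exact ⟨Y, Z, fun _ _ => ⟨hf, h1, h2, h3⟩⟩
    · exact ⟨fun _ _ => 0, fun _ _ => 0, fun h1 h2 => absurd ⟨h1, h2⟩ h⟩
  choose Y Z hYZ using hex
  set t₀ : ℝ → ℝ := fun τ => max (max τ 0 - 1) 0 with ht₀
  -- A trajectory reaching `η = 1` at time `τ` starts at `t₀ τ`, either on the initial profile or at
  -- `η = 0`. Subtracting `S 0` makes the starting value independent of `S` when `τ ≤ 1`, although
  -- the operator acts on functions with arbitrary `S 0`; the fixed point has `S 0 = 0`. Negative
  -- times are frozen at 0.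
  set b : (ℝ → ℝ) → ℝ → ℝ := fun S τ => q (max (1 - max τ 0) 0) - (S (t₀ τ) - S 0) with hb
  have ht₀0 : ∀ τ, 0 ≤ t₀ τ := fun τ => le_max_right _ _
  have ht₀1 : ∀ τ, max τ 0 - t₀ τ ≤ 1 := fun τ => by
    have : max τ 0 - 1 ≤ t₀ τ := le_max_left _ _
    linarith
  have ht₀τ : ∀ τ, t₀ τ ≤ max τ 0 := fun τ => max_le (by linarith) (le_max_right _ _)
  suffices hfix : ∃ S, Continuous S ∧ HasExpGrowth l S ∧
      (fun τ => ΦF - Y S (max τ 0) (Z S (t₀ τ) (b S τ))) = S by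
    obtain ⟨S, hSc, hSg, hSF⟩ := hfix
    obtain ⟨hf, h1, h2, h3⟩ := hYZ S hSc hSg
    have hS0 : S 0 = 0 := by
      have := congrFun hSF 0
      simp only [max_self, zero_sub, ht₀, hb] at this
      norm_num [h1, hq1] at this
      exact this.symm
    refine ⟨S, Y S, Z S, hSc, hf, h1, h2, h3, hS0, fun τ hτ => ?_⟩
    have := congrFun hSF τ
    simp only [ht₀, hb, max_eq_left hτ, hS0, sub_zero] at this
    exact this.symm
  refine exists_fixedPoint_of_weighted_contraction l
    (fun S τ => ΦF - Y S (max τ 0) (Z S (t₀ τ) (b S τ))) ?_ ?_ ?_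
  · intro S hS hSg
    obtain ⟨hf, h1, h2, h3⟩ := hYZ S hS hSg
    have hYc := hf.continuous_uncurry hK hS hC
    have hZc := h3.continuous
    have : Continuous fun τ => Z S (t₀ τ) (b S τ) := hZc.comp
      ((by fun_prop : Continuous t₀).prodMk (by fun_prop : Continuous (b S)))
    have h4 : Continuous fun τ => Y S (max τ 0) (Z S (t₀ τ) (b S τ)) :=
      hYc.comp ((by fun_prop : Continuous fun τ : ℝ => max τ 0).prodMk this)
    exact continuous_const.sub h4
  · obtain ⟨hf, h1, h2, h3⟩ := hYZ (fun _ => 0) continuous_const ⟨0, by simp⟩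
    obtain ⟨B, hB⟩ := (isCompact_Icc (a := (0 : ℝ)) (b := 1)).exists_bound_of_continuousOn
      hq.continuousOn
    have hB0 : 0 ≤ B := (norm_nonneg _).trans (hB 0 (by simp))
    -- For zero input the bound is uniform in `τ`: a trajectory starts in the range of `q` on `[0,
    -- 1]` and runs for at most one unit of time.
    refine ⟨|ΦF| + gronwallBound B C |K 0| 1, fun τ => ?_⟩
    set y : ℝ → ℝ := fun r => Y (fun _ => 0) r (Z (fun _ => 0) (t₀ τ) (b (fun _ => 0) τ)) with hy
    have hyd : ∀ r, HasDerivAt y (K (y r + 0)) r := fun r => hf.hasDerivAt r _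
    have h4 := norm_le_gronwallBound_of_norm_deriv_right_le (f := y) (a := t₀ τ) (b := max τ 0)
      (f' := fun r => K (y r + 0))
      (fun r _ => (hyd r).continuousAt.continuousWithinAt) (fun r _ => (hyd r).hasDerivWithinAt)
      (δ := B) (K := C) (ε := |K 0|) (by
        simp only [hy, h1, hb, sub_self, sub_zero]
        refine hB _ ⟨le_max_right _ _, max_le ?_ zero_le_one⟩
        have := le_max_right τ 0
        linarith) (fun r _ => by
        have h5 := hLip (y r + 0) 0
        have h6 := abs_add_le (K (y r + 0) - K 0) (K 0)
        simp only [add_zero, sub_zero, sub_add_cancel, Real.norm_eq_abs] at h5 h6 ⊢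
        linarith) _ (right_mem_Icc.2 (ht₀τ τ))
    have h5 := gronwallBound_mono hB0 (abs_nonneg (K 0)) hC0 (ht₀1 τ)
    have h6 : (0 : ℝ) ≤ gronwallBound B C |K 0| 1 := (norm_nonneg _).trans (h4.trans h5)
    have h7 : 1 ≤ Real.exp (l * |τ|) := Real.one_le_exp (by positivity)
    have h8 : |ΦF - y (max τ 0)| ≤ |ΦF| + |y (max τ 0)| := abs_sub _ _
    rw [Real.norm_eq_abs] at h4
    calc _ ≤ |ΦF| + |y (max τ 0)| := h8
      _ ≤ (|ΦF| + gronwallBound B C |K 0| 1) * 1 := by linarith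
      _ ≤ _ := by gcongr
  · intro S₁ S₂ hS₁ hg₁ hS₂ hg₂ m hm τ
    have hm0 : 0 ≤ m := by simpa using (abs_nonneg _).trans (hm 0)
    obtain ⟨hf₁, h1₁, -, -⟩ := hYZ S₁ hS₁ hg₁
    obtain ⟨hf₂, h1₂, -, -⟩ := hYZ S₂ hS₂ hg₂
    have h := abs_sub_le_half_of_trajectories (t₀ := t₀ τ) (τ := max τ 0) (m := m) hLip hC0 hl
      (y₁ := fun r => Y S₁ r (Z S₁ (t₀ τ) (b S₁ τ))) (y₂ := fun r => Y S₂ r (Z S₂ (t₀ τ) (b S₂ τ)))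
      (S₁ := S₁) (S₂ := S₂) (ht₀τ τ) (ht₀1 τ) (hf₁.continuous_left _).continuousOn
      (hf₂.continuous_left _).continuousOn
      (fun r _ => (hf₁.hasDerivAt r _).hasDerivWithinAt)
      (fun r _ => (hf₂.hasDerivAt r _).hasDerivWithinAt)
      (fun r hr => by
        have := hm r
        rwa [abs_of_nonneg ((ht₀0 τ).trans hr.1)] at this) hm0 (by
        simp only [h1₁, h1₂, hb]
        -- Up to time 1 both trajectories start at the same point. Afterwards the gap is at most the
        -- input gaps at times `0` and `τ - 1`, which accounts for the factor 2.
        rcases le_total (max τ 0) 1 with h1 | h1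
        · have : t₀ τ = 0 := max_eq_right (by linarith)
          simp only [this, sub_self, sub_zero, abs_zero]
          positivity
        · have h2 : t₀ τ = max τ 0 - 1 := max_eq_left (by linarith)
          have h3 := hm (t₀ τ)
          have h4 := hm 0
          rw [abs_of_nonneg (ht₀0 τ), h2] at h3
          have h5 : 1 ≤ Real.exp (l * (max τ 0 - 1)) :=
            Real.one_le_exp (mul_nonneg hl0.le (by linarith))
          simp only [abs_zero, mul_zero, Real.exp_zero, mul_one] at h4
          rw [h2]
          have h6 : m * 1 ≤ m * Real.exp (l * (max τ 0 - 1)) := by gcongr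
          calc _ = |(S₂ 0 - S₁ 0) * (-1) - (S₁ (max τ 0 - 1) - S₂ (max τ 0 - 1))| := by
                congr 1; ring
            _ ≤ |S₁ 0 - S₂ 0| + |S₁ (max τ 0 - 1) - S₂ (max τ 0 - 1)| := by
                refine (abs_sub _ _).trans (le_of_eq ?_)
                congr 1
                congr 1; ring
            _ ≤ _ := by linarith)
    have h2 : Real.exp (l * max τ 0) ≤ Real.exp (l * |τ|) := by
      gcongr
      exact max_le (le_abs_self _) (abs_nonneg _)
    rw [sub_sub_sub_cancel_left, abs_sub_comm]
    refine h.trans ?_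
    gcongr

/-! ### Gluing `C¹` functions and the relaxed solution -/

theorem contDiffOn_one_of_hasDerivAt {U : Set ℝ} (hU : IsOpen U) {f f' : ℝ → ℝ}
    (hf : ∀ x ∈ U, HasDerivAt f (f' x) x) (hf' : ContinuousOn f' U) : ContDiffOn ℝ 1 f U := by
  rw [contDiffOn_one_iff_derivWithin hU.uniqueDiffOn]
  refine ⟨fun x hx => (hf x hx).differentiableAt.differentiableWithinAt, hf'.congr fun x hx => ?_⟩
  exact (hf x hx).hasDerivWithinAt.derivWithin (hU.uniqueDiffWithinAt hx)

theorem ContDiffOn.ite_le_zero {U : Set ℝ} (hU : IsOpen U) {f g : ℝ → ℝ}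
    (hf : ContDiffOn ℝ 1 f U) (hg : ContDiffOn ℝ 1 g U) (h0 : f 0 = g 0)
    (h0' : deriv f 0 = deriv g 0) : ContDiffOn ℝ 1 (fun x => if 0 ≤ x then f x else g x) U := by
  have hfd : ∀ x ∈ U, HasDerivAt f (deriv f x) x := fun x hx =>
    ((hf.differentiableOn one_ne_zero).differentiableAt (hU.mem_nhds hx)).hasDerivAt
  have hgd : ∀ x ∈ U, HasDerivAt g (deriv g x) x := fun x hx =>
    ((hg.differentiableOn one_ne_zero).differentiableAt (hU.mem_nhds hx)).hasDerivAt
  refine contDiffOn_one_of_hasDerivAt hU (f' := fun x => if 0 ≤ x then deriv f x else deriv g x)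
    (fun x hx => ?_) ?_
  · rcases lt_trichotomy x 0 with h | h | h
    · rw [if_neg (not_le.2 h)]
      refine (hgd x hx).congr_of_eventuallyEq ?_
      filter_upwards [gt_mem_nhds h] with y hy
      rw [if_neg (not_le.2 hy)]
    · subst h
      rw [if_pos le_rfl]
      have h1 : HasDerivWithinAt (fun x => if 0 ≤ x then f x else g x) (deriv f 0) (Ici 0) 0 :=
        (hfd 0 hx).hasDerivWithinAt.congr (fun y hy => if_pos hy) (if_pos le_rfl)
      have h2 : HasDerivWithinAt (fun x => if 0 ≤ x then f x else g x) (deriv f 0) (Iic 0) 0 := by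
        rw [h0']
        refine (hgd 0 hx).hasDerivWithinAt.congr (fun y hy => ?_) (by rw [if_pos le_rfl, h0])
        split_ifs with h3
        · rw [le_antisymm hy h3, h0]
        · rfl
      have := h2.union h1
      rwa [Iic_union_Ici, hasDerivWithinAt_univ] at this
    · rw [if_pos h.le]
      refine (hfd x hx).congr_of_eventuallyEq ?_
      filter_upwards [lt_mem_nhds h] with y hy
      rw [if_pos hy.le]
  · have hfc : ContinuousOn (deriv f) U := hf.continuousOn_deriv_of_isOpen hU le_rfl
    have hgc : ContinuousOn (deriv g) U := hg.continuousOn_deriv_of_isOpen hU le_rfl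
    refine ContinuousOn.if (p := fun x : ℝ => 0 ≤ x) ?_ (hfc.mono inter_subset_left)
      (hgc.mono inter_subset_left)
    rintro x ⟨_, hx⟩
    have : x = 0 := by
      have h1 : {a : ℝ | 0 ≤ a} = Ici 0 := rfl
      rw [h1, frontier_Ici] at hx
      exact hx
    rw [this, h0']

/-- A `C¹` function on `[0, 1]` extends to a `C¹` function on the line. -/
theorem exists_contDiff_extension {q : ℝ → ℝ} (hq : ContDiffOn ℝ 1 q (Icc 0 1)) :
    ∃ g : ℝ → ℝ, ContDiff ℝ 1 g ∧ EqOn g q (Icc 0 1) ∧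
      ∀ x ∈ Icc (0 : ℝ) 1, deriv g x = derivWithin q (Icc 0 1) x := by
  have hu : UniqueDiffOn ℝ (Icc (0 : ℝ) 1) := uniqueDiffOn_Icc zero_lt_one
  obtain ⟨hqd, hqc⟩ := (contDiffOn_one_iff_derivWithin hu).1 hq
  -- The derivative is continued by constants beyond the end points and then integrated.
  set d : ℝ → ℝ := fun x => derivWithin q (Icc 0 1) (projIcc 0 1 zero_le_one x) with hd
  have hdc : Continuous d := hqc.comp_continuous
    (continuous_subtype_val.comp continuous_projIcc) fun x => (projIcc 0 1 zero_le_one x).2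
  have hdeq : ∀ x ∈ Icc (0 : ℝ) 1, d x = derivWithin q (Icc 0 1) x := fun x hx => by
    simp only [hd, projIcc_of_mem _ hx]
  set g : ℝ → ℝ := fun x => q 0 + ∫ t in (0 : ℝ)..x, d t with hg
  have hgd : ∀ x, HasDerivAt g (d x) x := fun x =>
    (intervalIntegral.integral_hasDerivAt_right (hdc.intervalIntegrable 0 x)
      hdc.stronglyMeasurable.stronglyMeasurableAtFilter hdc.continuousAt).const_add _
  refine ⟨g, contDiff_one_iff_deriv.2 ⟨fun x => (hgd x).differentiableAt, ?_⟩, fun x hx => ?_,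
    fun x hx => by rw [(hgd x).deriv, hdeq x hx]⟩
  · rwa [show deriv g = d from funext fun x => (hgd x).deriv]
  · have h1 : ∀ y ∈ Ico (0 : ℝ) x, HasDerivWithinAt q (d y) (Ici y) y := fun y hy => by
      have hy1 : y ∈ Icc (0 : ℝ) 1 := ⟨hy.1, hy.2.le.trans hx.2⟩
      rw [hdeq y hy1]
      refine (hqd y hy1).hasDerivWithinAt.mono_of_mem_nhdsWithin ?_
      exact mem_of_superset (Icc_mem_nhdsGE (hy.2.trans_le hx.2)) (Icc_subset_Icc_left hy.1)
    exact eq_of_has_deriv_right_eq (fun y _ => (hgd y).hasDerivWithinAt) h1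
      (fun y _ => (hgd y).continuousAt.continuousWithinAt)
      (hqd.continuousOn.mono (Icc_subset_Icc_right hx.2)) (by simp [hg]) x (right_mem_Icc.2 hx.1)

theorem IsFlow.hasDerivAt_comp {K S : ℝ → ℝ} {Y : ℝ → ℝ → ℝ} {C : ℝ} (h : IsFlow K S Y)
    (hK : ContDiff ℝ 1 K) (hS : Continuous S) (hC : ∀ x, |deriv K x| ≤ C) {f g : ℝ → ℝ}
    {f' g' x : ℝ} (hf : HasDerivAt f f' x) (hg : HasDerivAt g g' x) :
    HasDerivAt (fun x => Y (f x) (g x))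
      (f' * K (Y (f x) (g x) + S (f x)) + g' * flowDeriv K S Y (f x) (g x)) x := by
  have := ((h.hasStrictFDerivAt hK hS hC (f x, g x)).hasFDerivAt).comp_hasDerivAt x
    (hf.prodMk hg)
  refine this.congr_deriv ?_
  simp

/-- A global `C¹` solution of the transport problem in which the input `s = 1 / N` is allowed to
take any sign; `p` is the derivative of `Q` in `η`. -/
structure IsRelaxedSolution (K : ℝ → ℝ) (ΦF : ℝ) (q : ℝ → ℝ) (Q p : ℝ → ℝ → ℝ) (s : ℝ → ℝ) :
    Prop where
  contDiff : ContDiff ℝ 1 fun x : ℝ × ℝ => Q x.1 x.2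
  continuous_input : Continuous s
  continuous_deriv : Continuous fun x : ℝ × ℝ => p x.1 x.2
  hasDerivAt_right : ∀ τ η, HasDerivAt (fun y => Q τ y) (p τ η) η
  hasDerivAt_left : ∀ τ, 0 ≤ τ → ∀ η, HasDerivAt (fun r => Q r η) (s τ + K (Q τ η) - p τ η) τ
  hasDerivAt_char : ∀ τ, 0 ≤ τ → ∀ x,
    HasDerivAt (fun r => p r (x + r)) (deriv K (Q τ (x + τ)) * p τ (x + τ)) τ
  nonneg_char : ∀ x r τ, 0 ≤ p r (x + r) → 0 ≤ p τ (x + τ)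
  left : ∀ τ, 0 ≤ τ → Q τ 0 = 0
  right : ∀ τ, 0 ≤ τ → Q τ 1 = ΦF
  initial : ∀ η ∈ Icc (0 : ℝ) 1, Q 0 η = q η

theorem exists_isRelaxedSolution {K : ℝ → ℝ} {C ΦF : ℝ} (hK : ContDiff ℝ 1 K)
    (hC : ∀ x, |deriv K x| ≤ C) {q : ℝ → ℝ} (hq : ContDiff ℝ 1 q) (hq0 : q 0 = 0)
    (hq1 : q 1 = ΦF) (hcompat : deriv q 1 - deriv q 0 = K ΦF - K 0) :
    ∃ Q p s, IsRelaxedSolution K ΦF q Q p s := by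
  obtain ⟨S, Y, Z, hSc, hf, hYZ, hZY, hZ, hS0, hS⟩ := exists_renewal hK hC hq.continuous hq1
  have hYd := hf.contDiff hK hSc hC
  have hZ0 : ∀ β, Z 0 β = β := fun β => by simpa [hf.zero] using hZY 0 β
  -- `a x` is the time-0 label of the characteristic `η - τ = x`. For `x < 0` it enters at `η = 0`
  -- at time `-x`, where `Q = 0` means `Y = -S`.
  set a : ℝ → ℝ := fun x => if 0 ≤ x then q x else Z (-x) (-S (-x)) with ha
  -- `R` agrees with `S` for `τ ≥ 0` but continues it through `τ = 0` by the renewal formula, so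
  -- that it can be differentiated there from both sides.
  set R : ℝ → ℝ := fun τ => ΦF - Y τ (a (1 - τ)) with hR
  have hRS : ∀ τ, 0 ≤ τ → S τ = R τ := by
    intro τ hτ
    rw [hS τ hτ]
    rcases le_or_gt τ 1 with h | h
    · rw [max_eq_right (by linarith), max_eq_left (by linarith), hS0, hZ0, sub_zero]
      simp only [hR, ha]
      rw [if_pos (by linarith)]
    · rw [max_eq_left (by linarith), max_eq_right (by linarith), hq0, zero_sub]
      simp only [hR, ha]
      rw [if_neg (by linarith), neg_sub]
  have haR : ∀ x, a x = if 0 ≤ x then q x else Z (-x) (-R (-x)) := by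
    intro x
    simp only [ha]
    split_ifs with h
    · rfl
    · rw [hRS (-x) (by linarith)]
  have hstepR : ∀ c : ℝ, ContDiffOn ℝ 1 a (Ioi (-c)) → ContDiffOn ℝ 1 R (Iio (c + 1)) := by
    intro c hc
    have h1 : ContDiffOn ℝ 1 (fun τ : ℝ => a (1 - τ)) (Iio (c + 1)) :=
      hc.comp (by fun_prop) fun τ hτ => by
        simp only [mem_Iio, mem_Ioi] at hτ ⊢; linarith
    exact contDiffOn_const.sub (hYd.comp_contDiffOn (contDiffOn_id.prodMk h1))
  -- Because of the unit delay, regularity of `a` on `x > -n` gives regularity of `R` on `τ < n +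
  -- 1`, hence of the branch for entering characteristics on `x > -(n + 1)`.
  have ha1 : ∀ n : ℕ, ContDiffOn ℝ 1 a (Ioi (-(n : ℝ))) := by
    intro n
    induction n with
    | zero =>
      refine hq.contDiffOn.congr fun x hx => ?_
      have : (0 : ℝ) < x := by simpa using hx
      simp only [ha, if_pos this.le]
    | succ n ih =>
      have hR1 := hstepR _ ih
      have hZ1 : ContDiffOn ℝ 1 (fun x : ℝ => Z (-x) (-R (-x))) (Ioi (-((n + 1 : ℕ) : ℝ))) := by
        refine hZ.comp_contDiffOn (contDiffOn_id.neg.prodMk ?_)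
        refine (hR1.comp (g := R) (f := fun x : ℝ => -x) contDiffOn_id.neg fun x hx => ?_).neg
        simp only [mem_Iio, mem_Ioi] at hx ⊢
        push_cast at hx
        linarith
      have hR0 : R 0 = 0 := by rw [← hRS 0 le_rfl, hS0]
      have hz0 : Z (-0) (-R (-0)) = 0 := by simp [hZ0, hR0]
      have hmem : (0 : ℝ) ∈ Ioi (-((n + 1 : ℕ) : ℝ)) := by
        simp only [mem_Ioi]; push_cast
        have : (0 : ℝ) ≤ n := n.cast_nonneg
        linarith
      have hzd := ((hZ1.differentiableOn one_ne_zero).differentiableAt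
        (isOpen_Ioi.mem_nhds hmem)).hasDerivAt
      have had : HasDerivAt (fun τ : ℝ => a (1 - τ)) (-deriv q 1) 0 := by
        have h1 : HasDerivAt a (deriv q 1) (1 - 0) := by
          rw [sub_zero]
          refine (hq.differentiable one_ne_zero 1).hasDerivAt.congr_of_eventuallyEq ?_
          filter_upwards [lt_mem_nhds (zero_lt_one' ℝ)] with x hx
          simp only [ha, if_pos hx.le]
        have h2 := h1.comp (0 : ℝ) ((hasDerivAt_id (0 : ℝ)).const_sub 1)
        simpa using! h2
      have ha1' : a 1 = ΦF := by simp only [ha, if_pos zero_le_one, hq1]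
      have hRd : HasDerivAt R (deriv q 1 - K ΦF) 0 := by
        have := (hf.hasDerivAt_comp hK hSc hC (hasDerivAt_id (0 : ℝ)) had).const_sub ΦF
        refine this.congr_deriv ?_
        simp [hf.zero, hS0, ha1', flowDeriv]
        ring
      have hRd' : HasDerivAt (fun x : ℝ => -R (-x)) (deriv q 1 - K ΦF) 0 := by
        have h1 : HasDerivAt R (deriv q 1 - K ΦF) (-(0 : ℝ)) := by rwa [neg_zero]
        have := (h1.comp (0 : ℝ) (hasDerivAt_neg (0 : ℝ))).neg
        simpa using! this
      -- Differentiating `Y (-x) (z x) = -R (-x)` at 0 gives `z'(0) = q'(1) - K ΦF + K 0`, which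
      -- equals `q'(0)` exactly by compatibility.
      have hYz := hf.hasDerivAt_comp hK hSc hC (hasDerivAt_neg (0 : ℝ)) hzd
      simp only [hYZ, hz0] at hYz
      have hval := hYz.unique hRd'
      simp [hf.zero, hS0, flowDeriv] at hval
      refine (ContDiffOn.ite_le_zero isOpen_Ioi hq.contDiffOn hZ1 (by rw [hz0, hq0]) ?_).congr
        fun x _ => haR x
      linarith
  have haC : ContDiff ℝ 1 a := contDiff_iff_contDiffAt.2 fun x => by
    obtain ⟨n, hn⟩ := exists_nat_gt (-x)
    exact (ha1 n).contDiffAt (isOpen_Ioi.mem_nhds (by simp only [mem_Ioi]; linarith))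
  have hRC : ContDiff ℝ 1 R := by
    have h1 : ContDiff ℝ 1 (fun τ : ℝ => a (1 - τ)) := haC.comp (by fun_prop)
    exact contDiff_const.sub (hYd.comp (contDiff_id.prodMk h1))
  have had : ∀ x, HasDerivAt a (deriv a x) x := fun x =>
    (haC.differentiable one_ne_zero x).hasDerivAt
  have hflow := hf.continuous_flowDeriv hK hSc hC
  have hac := haC.continuous
  have ha'c : Continuous (deriv a) := haC.continuous_deriv le_rfl
  refine ⟨fun τ η => R τ + Y τ (a (η - τ)),
    fun τ η => deriv a (η - τ) * flowDeriv K S Y τ (a (η - τ)), deriv R, ?_⟩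
  refine ⟨?_, hRC.continuous_deriv le_rfl, ?_, fun τ η => ?_, fun τ hτ η => ?_, fun τ hτ x => ?_,
    fun x r τ h => ?_, fun τ hτ => ?_, fun τ hτ => ?_, fun η hη => ?_⟩
  · have h1 : ContDiff ℝ 1 fun x : ℝ × ℝ => a (x.2 - x.1) := haC.comp (by fun_prop)
    exact (hRC.comp contDiff_fst).add (hYd.comp (contDiff_fst.prodMk h1))
  · have h1 : Continuous fun x : ℝ × ℝ => flowDeriv K S Y x.1 (a (x.2 - x.1)) :=
      hflow.comp (by fun_prop : Continuous fun x : ℝ × ℝ => (x.1, a (x.2 - x.1)))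
    fun_prop
  · have h1 : HasDerivAt (fun y : ℝ => a (y - τ)) (deriv a (η - τ)) η := by
      simpa using! (had (η - τ)).comp η ((hasDerivAt_id η).sub_const τ)
    have := (hf.hasDerivAt_comp hK hSc hC (hasDerivAt_const η τ) h1).const_add (R τ)
    simpa using this
  · have h1 : HasDerivAt (fun r : ℝ => a (η - r)) (-deriv a (η - τ)) τ := by
      simpa using! (had (η - τ)).comp τ ((hasDerivAt_id τ).const_sub η)
    have h2 := (hRC.differentiable one_ne_zero τ).hasDerivAt.add
      (hf.hasDerivAt_comp hK hSc hC (hasDerivAt_id τ) h1)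
    refine h2.congr_deriv ?_
    simp only [id, hRS τ hτ]
    rw [add_comm (R τ)]
    ring
  · have h1 := (hf.hasDerivAt_flowDeriv hK hSc τ (a x)).const_mul (deriv a x)
    simp only [add_sub_cancel_right]
    refine h1.congr_deriv ?_
    rw [hRS τ hτ, add_comm (R τ)]
    ring
  · simp only [add_sub_cancel_right] at h ⊢
    exact mul_nonneg (nonneg_of_mul_nonneg_left h (Real.exp_pos _)) (Real.exp_pos _).le
  · rcases hτ.eq_or_lt with h | h
    · subst h
      have h1 : a 0 = 0 := by simp only [ha, if_pos le_rfl, hq0]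
      simp only [sub_self, hf.zero, h1, ← hRS 0 le_rfl, hS0, add_zero]
    · rw [haR, if_neg (by linarith)]
      simp only [zero_sub, neg_neg, hYZ]
      ring
  · simp only [hR]
    ring
  · rw [← hRS 0 le_rfl, hS0, sub_zero, hf.zero, zero_add]
    simp only [ha, if_pos hη.1]

/-! ### Classical solutions coincide with the relaxed one -/

theorem timeInterval_mem_nhdsWithin {T : EReal} {τ : ℝ} (hτ : τ ∈ timeInterval T) :
    timeInterval T ∈ 𝓝[Ici 0] τ := by
  have h : {t : ℝ | (t : EReal) < T} ∈ 𝓝 τ :=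
    (isOpen_Iio.preimage continuous_coe_real_ereal).mem_nhds hτ.2
  filter_upwards [self_mem_nhdsWithin, mem_nhdsWithin_of_mem_nhds h] with t h1 h2 using ⟨h1, h2⟩

theorem timeInterval_of_le {T : EReal} {τ r : ℝ} (hτ : τ ∈ timeInterval T) (h0 : 0 ≤ r)
    (hr : r ≤ τ) : r ∈ timeInterval T :=
  ⟨h0, (EReal.coe_le_coe_iff.2 hr).trans_lt hτ.2⟩

theorem exists_gt_mem_timeInterval {T : EReal} {τ : ℝ} (hτ : τ ∈ timeInterval T) :
    ∃ τ' ∈ timeInterval T, τ < τ' := by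
  obtain ⟨x, h1, h2⟩ := EReal.lt_iff_exists_real_btwn.1 hτ.2
  have h3 : τ < x := EReal.coe_lt_coe_iff.1 h1
  exact ⟨x, ⟨hτ.1.trans h3.le, h2⟩, h3⟩

theorem lipschitzWith_of_abs_sub_le {K : ℝ → ℝ} {C : ℝ} (hC0 : 0 ≤ C)
    (hC : ∀ x y, |K x - K y| ≤ C * |x - y|) : LipschitzWith C.toNNReal K :=
  LipschitzWith.of_dist_le_mul fun x y => by
    rw [Real.dist_eq, Real.dist_eq, Real.coe_toNNReal _ hC0]
    exact hC x y

namespace IsRelaxedSolution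

variable {K : ℝ → ℝ} {ΦF : ℝ} {q : ℝ → ℝ} {Q p : ℝ → ℝ → ℝ} {s : ℝ → ℝ}

theorem hasDerivAt_along_char (h : IsRelaxedSolution K ΦF q Q p s) {τ : ℝ} (hτ : 0 ≤ τ) (x : ℝ) :
    HasDerivAt (fun r => Q r (x + r)) (s τ + K (Q τ (x + τ))) τ := by
  have hf := (h.contDiff.differentiable one_ne_zero (τ, x + τ)).hasFDerivAt
  have h1 := hf.comp_hasDerivAt (x + τ) ((hasDerivAt_const (x + τ) τ).prodMk (hasDerivAt_id _))
  have h2 := hf.comp_hasDerivAt τ ((hasDerivAt_id τ).prodMk (hasDerivAt_const τ (x + τ)))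
  have h3 := hf.comp_hasDerivAt τ ((hasDerivAt_id τ).prodMk ((hasDerivAt_id τ).const_add x))
  refine h3.congr_deriv ?_
  have e1 := h1.unique (h.hasDerivAt_right τ (x + τ))
  have e2 := h2.unique (h.hasDerivAt_left τ hτ (x + τ))
  rw [show ((1 : ℝ), (1 : ℝ)) = (0, 1) + (1, 0) by simp, map_add, e1, e2]
  ring

end IsRelaxedSolution

namespace IsClassicalSolution

variable {K : ℝ → ℝ} {ΦF : ℝ} {Qinit : ℝ → ℝ} {T : EReal} {Q : ℝ → ℝ → ℝ} {N : ℝ → ℝ}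

theorem hasDerivWithinAt_left (h : IsClassicalSolution K ΦF Qinit T Q N) {τ η : ℝ}
    (hτ : τ ∈ timeInterval T) (hη : η ∈ Icc (0 : ℝ) 1) :
    HasDerivWithinAt (fun r => Q r η) (dTau Q τ η) (Ici 0) τ := by
  have hf := (h.contDiffOn.differentiableOn one_ne_zero (τ, η) ⟨hτ, hη⟩).hasFDerivWithinAt
  have h1 := hf.comp_hasDerivWithinAt τ (s := timeInterval T)
    ((hasDerivWithinAt_id τ _).prodMk (hasDerivWithinAt_const τ _ η))
    (fun r hr => mk_mem_prod hr hη)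
  exact (h1.mono_of_mem_nhdsWithin
    (timeInterval_mem_nhdsWithin hτ)).differentiableWithinAt.hasDerivWithinAt

/-- Only a right derivative is available, since the characteristic may just have entered at `η = 0`
or at `τ = 0`; the chain rule then combines the two one-sided partial derivatives. -/
theorem hasDerivWithinAt_char (h : IsClassicalSolution K ΦF Qinit T Q N) {τ x : ℝ}
    (hτ : τ ∈ timeInterval T) (hη : x + τ ∈ Ico (0 : ℝ) 1) :
    HasDerivWithinAt (fun r => Q r (x + r)) (1 / N τ + K (Q τ (x + τ))) (Ici τ) τ := by
  have hη' : x + τ ∈ Icc (0 : ℝ) 1 := Ico_subset_Icc_self hη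
  have hf := (h.contDiffOn.differentiableOn one_ne_zero (τ, x + τ) ⟨hτ, hη'⟩).hasFDerivWithinAt
  have h1 := hf.comp_hasDerivWithinAt (x + τ) (s := Icc (0 : ℝ) 1)
    ((hasDerivWithinAt_const (x + τ) _ τ).prodMk (hasDerivWithinAt_id _ _))
    (fun r hr => mk_mem_prod hτ hr)
  have h2 := hf.comp_hasDerivWithinAt τ (s := timeInterval T)
    ((hasDerivWithinAt_id τ _).prodMk (hasDerivWithinAt_const τ _ (x + τ)))
    (fun r hr => mk_mem_prod hr hη')
  have e1 := h1.derivWithin (uniqueDiffOn_Icc zero_lt_one _ hη')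
  have e2 := (h2.mono_of_mem_nhdsWithin
    (timeInterval_mem_nhdsWithin hτ)).derivWithin (uniqueDiffOn_Ici 0 _ hτ.1)
  have h3 := hf.comp_hasDerivWithinAt τ (s := timeInterval T ∩ Ico τ (1 - x))
    ((hasDerivWithinAt_id τ _).prodMk ((hasDerivWithinAt_id τ _).const_add x))
    (fun r hr => mk_mem_prod hr.1 (by
      have := hr.2.1; have := hr.2.2; have := hη.1
      constructor <;> simp only [id] <;> linarith))
  have hmem : timeInterval T ∩ Ico τ (1 - x) ∈ 𝓝[Ici τ] τ := by
    refine inter_mem (nhdsWithin_mono _ (Ici_subset_Ici.2 hτ.1) (timeInterval_mem_nhdsWithin hτ)) ?_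
    exact Ico_mem_nhdsGE (by linarith [hη.2])
  refine (h3.mono_of_mem_nhdsWithin hmem).congr_deriv ?_
  rw [show ((1 : ℝ), (1 : ℝ)) = (0, 1) + (1, 0) by simp, map_add, ← h.equation τ hτ _ hη', dTau,
    dEta, add_comm]
  exact congrArg₂ _ e2.symm e1.symm

theorem continuousOn_char (h : IsClassicalSolution K ΦF Qinit T Q N) {a b x : ℝ}
    (hb : b ∈ timeInterval T) (ha : 0 ≤ a) (hxa : 0 ≤ x + a) (hxb : x + b ≤ 1) :
    ContinuousOn (fun r => Q r (x + r)) (Icc a b) :=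
  h.contDiffOn.continuousOn.comp (f := fun r : ℝ => (r, x + r)) (by fun_prop) fun r hr =>
    ⟨timeInterval_of_le hb (ha.trans hr.1) hr.2, by linarith [hr.1], by linarith [hr.2]⟩

/-- Inserting the formula for `1 / N` into the equation at `η = 1` leaves `y' = K y - K ΦF`, which
has the constant solution `ΦF`. -/
theorem map_one {C : ℝ} (h : IsClassicalSolution K ΦF Qinit T Q N) (hC0 : 0 ≤ C)
    (hC : ∀ x y, |K x - K y| ≤ C * |x - y|) {τ : ℝ} (hτ : τ ∈ timeInterval T) : Q τ 1 = ΦF := by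
  have h1 : (1 : ℝ) ∈ Icc (0 : ℝ) 1 := right_mem_Icc.2 zero_le_one
  have hL := lipschitzWith_of_abs_sub_le hC0 hC
  have hd : ∀ r ∈ timeInterval T, HasDerivWithinAt (fun r => Q r 1) (K (Q r 1) - K ΦF) (Ici 0) r :=
    fun r hr => (h.hasDerivWithinAt_left hr h1).congr_deriv (by
      have e1 := h.equation r hr 1 h1
      have e2 := h.rate_eq r hr
      linarith)
  have hmem : ∀ r ∈ Icc 0 τ, r ∈ timeInterval T := fun r hr => timeInterval_of_le hτ hr.1 hr.2
  exact ODE_solution_unique (v := fun _ y => K y - K ΦF) (a := 0) (b := τ) (f := fun r => Q r 1)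
    (g := fun _ => ΦF) (K := C.toNNReal)
    (fun _ => LipschitzWith.of_dist_le_mul fun x y => by
      rw [dist_sub_right]; exact hL.dist_le_mul x y)
    (fun r hr => ((hd r (hmem r hr)).continuousWithinAt).mono Icc_subset_Ici_self)
    (fun r hr => (hd r (hmem r (Ico_subset_Icc_self hr))).mono (Ici_subset_Ici.2 hr.1))
    continuousOn_const
    (fun r _ => by simpa using hasDerivWithinAt_const r (Ici r) ΦF)
    (by rw [h.initial 1 h1, h.data.map_one]) (right_mem_Icc.2 hτ.1)

theorem input_eq {C : ℝ} (h : IsClassicalSolution K ΦF Qinit T Q N) (hC0 : 0 ≤ C)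
    (hC : ∀ x y, |K x - K y| ≤ C * |x - y|) {q : ℝ → ℝ} {Q' p : ℝ → ℝ → ℝ} {s : ℝ → ℝ}
    (hr : IsRelaxedSolution K ΦF q Q' p s) (hq : EqOn q Qinit (Icc 0 1)) {τ : ℝ}
    (hτ : τ ∈ timeInterval T) : 1 / N τ = s τ := by
  -- An interval reaching beyond `τ` is nondegenerate even if `τ = 0`, so equality of the integrated
  -- inputs on it determines their derivatives at `τ`.
  obtain ⟨b, hb, hτb⟩ := exists_gt_mem_timeInterval hτ
  have hb0 : 0 < b := hτ.1.trans_lt hτb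
  have hmemb : ∀ r ∈ Icc 0 b, r ∈ timeInterval T := fun r hr => timeInterval_of_le hb hr.1 hr.2
  set s₁ : ℝ → ℝ := fun t => 1 / N (projIcc 0 b hb0.le t) with hs₁
  have hs₁c : Continuous s₁ := by
    have h1 : ContinuousOn (fun t => 1 / N t) (timeInterval T) :=
      continuousOn_const.div h.continuousOn_rate fun t ht => (h.rate_pos t ht).ne'
    exact h1.comp_continuous (continuous_subtype_val.comp continuous_projIcc)
      fun t => hmemb _ (projIcc 0 b hb0.le t).2
  have hs₁e : ∀ t ∈ Icc 0 b, s₁ t = 1 / N t := fun t ht => by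
    simp only [hs₁, projIcc_of_mem _ ht]
  set S₁ : ℝ → ℝ := fun t => ∫ r in (0 : ℝ)..t, s₁ r with hS₁
  set S₂ : ℝ → ℝ := fun t => ∫ r in (0 : ℝ)..t, s r with hS₂
  have hS₁d : ∀ t, HasDerivAt S₁ (s₁ t) t := fun t =>
    intervalIntegral.integral_hasDerivAt_right (hs₁c.intervalIntegrable 0 t)
      hs₁c.stronglyMeasurable.stronglyMeasurableAtFilter hs₁c.continuousAt
  have hsc := hr.continuous_input
  have hS₂d : ∀ t, HasDerivAt S₂ (s t) t := fun t =>
    intervalIntegral.integral_hasDerivAt_right (hsc.intervalIntegrable 0 t)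
      hsc.stronglyMeasurable.stronglyMeasurableAtFilter hsc.continuousAt
  have hS₁c : Continuous S₁ := continuous_iff_continuousAt.2 fun t => (hS₁d t).continuousAt
  have hS₂c : Continuous S₂ := continuous_iff_continuousAt.2 fun t => (hS₂d t).continuousAt
  have hS₁0 : S₁ 0 = 0 := by simp [hS₁]
  have hS₂0 : S₂ 0 = 0 := by simp [hS₂]
  have hzero : ∀ t ∈ Icc 0 b, S₁ t = S₂ t := by
    obtain ⟨l, hl⟩ : ∃ l, l = 9 * C + 8 := ⟨_, rfl⟩
    have hl0 : 0 < l := by linarith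
    -- At a maximum point `t` of the weighted gap, with value `m`, the characteristics arriving at
    -- `η = 1` are compared. Both end at `ΦF`, so their gap in `Q - S` is `|S₁ t - S₂ t|`, and
    -- halving gives `m ≤ m / 2`.
    obtain ⟨t, ht, hmax⟩ := (isCompact_Icc (a := 0) (b := b)).exists_isMaxOn
      ⟨0, left_mem_Icc.2 hb0.le⟩
      (f := fun r => |S₁ r - S₂ r| * Real.exp (-(l * r))) (by fun_prop)
    obtain ⟨m, hm⟩ : ∃ m, m = |S₁ t - S₂ t| * Real.exp (-(l * t)) := ⟨_, rfl⟩
    have hm0 : 0 ≤ m := by rw [hm]; positivity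
    have hle : ∀ r ∈ Icc 0 b, |S₁ r - S₂ r| ≤ m * Real.exp (l * r) := fun r hr => by
      have h1 : |S₁ r - S₂ r| * Real.exp (-(l * r)) ≤ m := hm ▸ hmax hr
      rwa [Real.exp_neg, ← div_eq_mul_inv, div_le_iff₀ (Real.exp_pos _)] at h1
    obtain ⟨t₀, ht₀⟩ : ∃ t₀, t₀ = max (t - 1) 0 := ⟨_, rfl⟩
    have ht₀0 : 0 ≤ t₀ := ht₀ ▸ le_max_right _ _
    have ht₀1 : t - 1 ≤ t₀ := ht₀ ▸ le_max_left _ _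
    have ht₀t : t₀ ≤ t := ht₀ ▸ max_le (by linarith) ht.1
    have hsub : ∀ r ∈ Icc t₀ t, r ∈ Icc 0 b := fun r hr =>
      ⟨ht₀0.trans hr.1, hr.2.trans ht.2⟩
    have hQc : ∀ r, 0 ≤ r → HasDerivAt (fun r => Q' r (1 - t + r))
      (s r + K (Q' r (1 - t + r))) r := fun r hr0 => hr.hasDerivAt_along_char hr0 _
    have key := abs_sub_le_half_of_trajectories (t₀ := t₀) (τ := t) (m := m) hC hC0 hl
      (y₁ := fun r => Q r (1 - t + r) - S₁ r) (y₂ := fun r => Q' r (1 - t + r) - S₂ r)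
      (S₁ := S₁) (S₂ := S₂) ht₀t (by linarith)
      ((h.continuousOn_char (hmemb t ht) ht₀0 (by linarith) (by linarith)).sub
        hS₁c.continuousOn)
      (fun r hr' => ((hQc r (hsub r hr').1).continuousAt.sub
        hS₂c.continuousAt).continuousWithinAt)
      (fun r hr' => by
        have hrb := hsub r (Ico_subset_Icc_self hr')
        refine ((h.hasDerivWithinAt_char (hmemb r hrb) (x := 1 - t)
          ⟨by linarith [hr'.1], by linarith [hr'.2]⟩).sub
            (hS₁d r).hasDerivWithinAt).congr_deriv ?_
        rw [hs₁e r hrb, sub_add_cancel]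
        ring)
      (fun r hr' => by
        refine ((hQc r (ht₀0.trans hr'.1)).sub (hS₂d r)).hasDerivWithinAt.congr_deriv ?_
        rw [sub_add_cancel]
        ring)
      (fun r hr' => hle r (hsub r hr')) hm0 (by
        rcases le_total t 1 with h1 | h1
        · have h2 : t₀ = 0 := by rw [ht₀]; exact max_eq_right (by linarith)
          have h3 : 1 - t + 0 ∈ Icc (0 : ℝ) 1 := ⟨by linarith, by linarith [ht.1]⟩
          simp only [h2, hS₁0, hS₂0]
          rw [h.initial _ h3, hr.initial _ h3, hq h3, sub_self, abs_zero]
          positivity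
        · have h2 : t₀ = t - 1 := by rw [ht₀]; exact max_eq_left (by linarith)
          have h3 := hle t₀ (hsub _ (left_mem_Icc.2 ht₀t))
          simp only [h2] at h3 ⊢
          rw [show 1 - t + (t - 1) = 0 by ring, h.boundary _ (hmemb _ ⟨by linarith, by linarith [ht.2]⟩),
            hr.left _ (by linarith), abs_sub_comm]
          have h4 : (0 : ℝ) - S₂ (t - 1) - (0 - S₁ (t - 1)) = S₁ (t - 1) - S₂ (t - 1) := by ring
          rw [h4]
          have h5 : 0 ≤ m * Real.exp (l * (t - 1)) := by positivity
          linarith)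
    simp only [sub_add_cancel] at key
    rw [h.map_one hC0 hC (hmemb t ht), hr.right t ht.1, sub_sub_sub_cancel_left, abs_sub_comm]
      at key
    have hm2 : m ≤ m / 2 := by
      calc m = |S₁ t - S₂ t| * Real.exp (-(l * t)) := hm
        _ ≤ m / 2 * Real.exp (l * t) * Real.exp (-(l * t)) := by gcongr
        _ = m / 2 := by rw [mul_assoc, ← Real.exp_add, add_neg_cancel, Real.exp_zero, mul_one]
    have hm3 : m = 0 := by linarith
    intro r hr
    have := hle r hr
    rw [hm3, zero_mul] at this
    exact sub_eq_zero.1 (abs_nonpos_iff.1 this)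
  have hτm : τ ∈ Icc 0 b := ⟨hτ.1, hτb.le⟩
  have hu := uniqueDiffOn_Icc hb0 τ hτm
  have h1 := ((hS₁d τ).hasDerivWithinAt (s := Icc 0 b)).derivWithin hu
  have h2 := (((hS₂d τ).hasDerivWithinAt (s := Icc 0 b)).congr hzero
    (hzero τ hτm)).derivWithin hu
  rw [← hs₁e τ hτm, ← h1, h2]

/-- Once the inputs agree, both solutions obey the same Lipschitz equation along the characteristic
through `(τ, η)`, with the same starting value on the initial profile or at `η = 0`. -/
theorem eqOn_relaxed {C : ℝ} (h : IsClassicalSolution K ΦF Qinit T Q N) (hC0 : 0 ≤ C)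
    (hC : ∀ x y, |K x - K y| ≤ C * |x - y|) {q : ℝ → ℝ} {Q' p : ℝ → ℝ → ℝ} {s : ℝ → ℝ}
    (hr : IsRelaxedSolution K ΦF q Q' p s) (hq : EqOn q Qinit (Icc 0 1)) {τ : ℝ}
    (hτ : τ ∈ timeInterval T) : EqOn (Q τ) (Q' τ) (Icc 0 1) := by
  intro η hη
  have hL := lipschitzWith_of_abs_sub_le hC0 hC
  obtain ⟨t₀, ht₀⟩ : ∃ t₀, t₀ = max (τ - η) 0 := ⟨_, rfl⟩
  have ht₀0 : 0 ≤ t₀ := ht₀ ▸ le_max_right _ _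
  have ht₀1 : τ - η ≤ t₀ := ht₀ ▸ le_max_left _ _
  have ht₀t : t₀ ≤ τ := ht₀ ▸ max_le (by linarith [hη.1]) hτ.1
  have hmem : ∀ r ∈ Icc t₀ τ, r ∈ timeInterval T := fun r hr =>
    timeInterval_of_le hτ (ht₀0.trans hr.1) hr.2
  have hQc : ∀ r, 0 ≤ r → HasDerivAt (fun r => Q' r (η - τ + r))
    (s r + K (Q' r (η - τ + r))) r := fun r hr0 => hr.hasDerivAt_along_char hr0 _
  have := ODE_solution_unique (v := fun t y => s t + K y) (a := t₀) (b := τ)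
    (f := fun r => Q r (η - τ + r)) (g := fun r => Q' r (η - τ + r)) (K := C.toNNReal)
    (fun _ => LipschitzWith.of_dist_le_mul fun x y => by
      rw [dist_add_left]; exact hL.dist_le_mul x y)
    (h.continuousOn_char hτ ht₀0 (by linarith) (by linarith [hη.2]))
    (fun r hr' => by
      have hrT := hmem r (Ico_subset_Icc_self hr')
      rw [← h.input_eq hC0 hC hr hq hrT]
      exact h.hasDerivWithinAt_char hrT ⟨by linarith [hr'.1], by linarith [hr'.2, hη.2]⟩)
    (fun r hr' => (hQc r (ht₀0.trans hr'.1)).continuousAt.continuousWithinAt)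
    (fun r hr' => (hQc r (ht₀0.trans hr'.1)).hasDerivWithinAt)
    (by
      rcases le_total τ η with h1 | h1
      · have h2 : t₀ = 0 := by rw [ht₀]; exact max_eq_right (by linarith)
        have h3 : η - τ + 0 ∈ Icc (0 : ℝ) 1 := ⟨by linarith, by linarith [hτ.1, hη.2]⟩
        simp only [h2]
        rw [h.initial _ h3, hr.initial _ h3, hq h3]
      · have h2 : t₀ = τ - η := by rw [ht₀]; exact max_eq_left (by linarith)
        have h3 := h.boundary t₀ (hmem _ (left_mem_Icc.2 ht₀t))
        have h4 := hr.left t₀ ht₀0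
        have h5 : η - τ + t₀ = 0 := by linarith
        simp only [h5, h3, h4]) (right_mem_Icc.2 ht₀t)
  simpa using this

end IsClassicalSolution

/-! ### Sign identities and the dissipation estimate -/

/-- Formally the integrand is the derivative of `|G|`. The sign is approximated by `y / (|y| +
1/(n+1))`, for which substitution gives an integral from 0 to 0; dominated convergence concludes. -/
theorem intervalIntegral_sign_mul_deriv_eq_zero {G G' : ℝ → ℝ} {a b : ℝ}
    (hG : ∀ x, HasDerivAt G (G' x) x) (hG' : Continuous G') (ha : G a = 0) (hb : G b = 0) :
    ∫ x in a..b, Real.sign (G x) * G' x = 0 := by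
  have hGc : Continuous G := continuous_iff_continuousAt.2 fun x => (hG x).continuousAt
  set ψ : ℕ → ℝ → ℝ := fun n y => y / (|y| + 1 / ((n : ℝ) + 1)) with hψ
  have hpos : ∀ (n : ℕ) (y : ℝ), 0 < |y| + 1 / ((n : ℝ) + 1) := fun n y => by positivity
  have hψc : ∀ n, Continuous (ψ n) := fun n =>
    continuous_id.div (by fun_prop) fun y => (hpos n y).ne'
  have hzero : ∀ n, ∫ x in a..b, ψ n (G x) * G' x = 0 := fun n => by
    have := intervalIntegral.integral_comp_mul_deriv (a := a) (b := b) (fun x _ => hG x)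
      hG'.continuousOn (hψc n)
    simp only [Function.comp_def] at this
    rw [this, ha, hb, intervalIntegral.integral_same]
  have hlim : Tendsto (fun n => ∫ x in a..b, ψ n (G x) * G' x) atTop
      (𝓝 (∫ x in a..b, Real.sign (G x) * G' x)) := by
    refine intervalIntegral.tendsto_integral_filter_of_dominated_convergence (fun x => |G' x|)
      (Eventually.of_forall fun n => ?_) (Eventually.of_forall fun n => ?_) ?_ ?_
    · exact (((hψc n).comp hGc).mul hG').aestronglyMeasurable
    · refine Eventually.of_forall fun x _ => ?_
      rw [Real.norm_eq_abs, abs_mul]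
      have : |ψ n (G x)| ≤ 1 := by
        simp only [hψ]
        rw [abs_div, abs_of_pos (hpos n _), div_le_one (hpos n _)]
        have : (0 : ℝ) ≤ 1 / ((n : ℝ) + 1) := by positivity
        linarith
      exact mul_le_of_le_one_left (abs_nonneg _) this
    · exact hG'.abs.intervalIntegrable _ _
    · refine Eventually.of_forall fun x _ => ?_
      refine Tendsto.mul_const _ ?_
      rcases eq_or_ne (G x) 0 with h | h
      · simp [hψ, h]
      · have h1 : Tendsto (fun n : ℕ => ψ n (G x)) atTop (𝓝 (G x / (|G x| + 0))) :=
          tendsto_const_nhds.div (tendsto_const_nhds.add tendsto_one_div_add_atTop_nhds_zero_nat)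
            (by simpa using h)
        rw [add_zero] at h1
        rcases lt_or_gt_of_ne h with h2 | h2
        · rwa [abs_of_neg h2, div_neg, div_self h, ← Real.sign_of_neg h2] at h1
        · rwa [abs_of_pos h2, div_self h, ← Real.sign_of_pos h2] at h1
  simp only [hzero] at hlim
  exact (tendsto_nhds_unique hlim tendsto_const_nhds)

theorem measurable_sign : Measurable Real.sign := by
  unfold Real.sign
  exact Measurable.ite (measurableSet_lt measurable_id measurable_const) measurable_const
    (Measurable.ite (measurableSet_lt measurable_const measurable_id) measurable_const
      measurable_const)

theorem abs_sign_le_one (x : ℝ) : |Real.sign x| ≤ 1 := by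
  rcases Real.sign_apply_eq x with h | h | h <;> simp [h]

theorem intervalIntegrable_bounded_mul {σ f : ℝ → ℝ} (hσ : Measurable σ) (h1 : ∀ x, |σ x| ≤ 1)
    (hf : Continuous f) (a b : ℝ) :
    IntervalIntegrable (fun x => σ x * f x) MeasureTheory.volume a b := by
  refine (hf.intervalIntegrable a b).mono_fun
    (hσ.mul hf.measurable).aestronglyMeasurable (Eventually.of_forall fun x => ?_)
  show ‖σ x * f x‖ ≤ ‖f x‖
  rw [norm_mul]
  exact mul_le_of_le_one_left (norm_nonneg _) (h1 x)

/-- A sign of `x` that never vanishes. -/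
noncomputable def strictSign (x : ℝ) : ℝ := if 0 ≤ x then 1 else -1

theorem strictSign_mul_self (x : ℝ) : strictSign x * x = |x| := by
  unfold strictSign
  split_ifs with h
  · rw [one_mul, abs_of_nonneg h]
  · rw [abs_of_neg (not_le.1 h)]; ring

theorem abs_strictSign (x : ℝ) : |strictSign x| = 1 := by
  unfold strictSign
  split_ifs <;> simp

theorem measurable_strictSign : Measurable strictSign :=
  Measurable.ite (measurableSet_le measurable_const measurable_id) measurable_const
    measurable_const

theorem strictSign_mul_le (x y : ℝ) : strictSign x * y ≤ |y| := by
  refine (le_abs_self _).trans ?_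
  rw [abs_mul, abs_strictSign, one_mul]

/-- Pointwise bound for an increasing nonnegative rate. -/
theorem neg_sign_mul_le_of_monotone {u v a b p q : ℝ} (ha : 0 ≤ a) (hb : 0 ≤ b) (hp : 0 ≤ p)
    (hq : 0 ≤ q) (h₁ : u ≤ v → a ≤ b) (h₂ : v ≤ u → b ≤ a) :
    -(Real.sign (u - v) * (a * p - b * q)) ≤ strictSign (p - q) * (a * p - b * q) := by
  -- If `u - v` and `p - q` have opposite signs, the two sides coincide. If the signs agree, `a * p`
  -- and `b * q` are ordered like `p` and `q`, so the left side is nonpositive and the right side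
  -- nonnegative.
  rcases lt_trichotomy u v with h | h | h
  · rw [Real.sign_of_neg (sub_neg.2 h)]
    have := h₁ h.le
    unfold strictSign
    split_ifs with h3
    · linarith
    · have : a * p ≤ b * q := mul_le_mul this (by linarith) hp hb
      linarith
  · have : a = b := le_antisymm (h₁ h.le) (h₂ h.ge)
    rw [h, sub_self, Real.sign_zero, zero_mul, neg_zero, this, ← mul_sub, mul_left_comm,
      strictSign_mul_self]
    positivity
  · rw [Real.sign_of_pos (sub_pos.2 h)]
    have := h₂ h.le
    unfold strictSign
    split_ifs with h3
    · have : b * q ≤ a * p := mul_le_mul this (by linarith) hq ha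
      linarith
    · linarith

/-- Pointwise bound for a decreasing nonnegative rate. -/
theorem sign_mul_le_of_antitone {u v a b p q : ℝ} (ha : 0 ≤ a) (hb : 0 ≤ b) (hp : 0 ≤ p)
    (hq : 0 ≤ q) (h₁ : u ≤ v → b ≤ a) (h₂ : v ≤ u → a ≤ b) :
    Real.sign (u - v) * (a * p - b * q) ≤ strictSign (p - q) * (a * p - b * q) := by
  have := neg_sign_mul_le_of_monotone (u := v) (v := u) ha hb hp hq h₂ h₁
  rwa [← neg_sub u v, Real.sign_neg, neg_mul, neg_neg] at this

/-- A primitive `H` of `h` is strictly increasing on `[0, Φ]`, so `Q₁ - Q₂` has the sign of `H ∘ Q₁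
- H ∘ Q₂`, whose derivative is the other factor. -/
theorem intervalIntegral_sign_sub_mul_eq_zero {h Q₁ Q₂ p₁ p₂ : ℝ → ℝ} {Φ : ℝ} (hh : Continuous h)
    (hpos : ∀ x ∈ Icc 0 Φ, 0 < h x) (hQ₁ : ∀ x, HasDerivAt Q₁ (p₁ x) x)
    (hQ₂ : ∀ x, HasDerivAt Q₂ (p₂ x) x) (hp₁ : Continuous p₁) (hp₂ : Continuous p₂)
    (hm₁ : ∀ x ∈ Icc (0 : ℝ) 1, Q₁ x ∈ Icc 0 Φ) (hm₂ : ∀ x ∈ Icc (0 : ℝ) 1, Q₂ x ∈ Icc 0 Φ)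
    (h0 : Q₁ 0 = Q₂ 0) (h1 : Q₁ 1 = Q₂ 1) :
    ∫ x in (0 : ℝ)..1, Real.sign (Q₁ x - Q₂ x) * (h (Q₁ x) * p₁ x - h (Q₂ x) * p₂ x) = 0 := by
  have hQ₁c : Continuous Q₁ := continuous_iff_continuousAt.2 fun x => (hQ₁ x).continuousAt
  have hQ₂c : Continuous Q₂ := continuous_iff_continuousAt.2 fun x => (hQ₂ x).continuousAt
  set H : ℝ → ℝ := fun x => ∫ t in (0 : ℝ)..x, h t with hH
  have hHd : ∀ x, HasDerivAt H (h x) x := fun x =>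
    intervalIntegral.integral_hasDerivAt_right (hh.intervalIntegrable 0 x)
      hh.stronglyMeasurable.stronglyMeasurableAtFilter hh.continuousAt
  have hmono : StrictMonoOn H (Icc 0 Φ) := by
    refine strictMonoOn_of_deriv_pos (convex_Icc 0 Φ)
      (fun x _ => (hHd x).continuousAt.continuousWithinAt) fun x hx => ?_
    rw [(hHd x).deriv]
    exact hpos x (interior_subset hx)
  have key := intervalIntegral_sign_mul_deriv_eq_zero (a := 0) (b := 1)
    (G := fun x => H (Q₁ x) - H (Q₂ x)) (G' := fun x => h (Q₁ x) * p₁ x - h (Q₂ x) * p₂ x)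
    (fun x => ((hHd _).comp x (hQ₁ x)).sub ((hHd _).comp x (hQ₂ x))) (by fun_prop)
    (by simp [h0]) (by simp [h1])
  refine Eq.trans (intervalIntegral.integral_congr fun x hx => ?_) key
  rw [uIcc_of_le zero_le_one] at hx
  have hs : Real.sign (Q₁ x - Q₂ x) = Real.sign (H (Q₁ x) - H (Q₂ x)) := by
    rcases lt_trichotomy (Q₁ x) (Q₂ x) with h3 | h3 | h3
    · rw [Real.sign_of_neg (sub_neg.2 h3),
        Real.sign_of_neg (sub_neg.2 (hmono (hm₁ x hx) (hm₂ x hx) h3))]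
    · rw [h3, sub_self, sub_self]
    · rw [Real.sign_of_pos (sub_pos.2 h3),
        Real.sign_of_pos (sub_pos.2 (hmono (hm₂ x hx) (hm₁ x hx) h3))]
  simp only [hs]

theorem mem_Icc_of_deriv_nonneg {Q p : ℝ → ℝ} {Φ : ℝ} (hQ : ∀ x, HasDerivAt Q (p x) x)
    (hp : ∀ x ∈ Icc (0 : ℝ) 1, 0 ≤ p x) (h0 : Q 0 = 0) (h1 : Q 1 = Φ) :
    MonotoneOn Q (Icc 0 1) ∧ ∀ x ∈ Icc (0 : ℝ) 1, Q x ∈ Icc 0 Φ := by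
  have hm : MonotoneOn Q (Icc 0 1) := by
    refine monotoneOn_of_deriv_nonneg (convex_Icc 0 1)
      (fun x _ => (hQ x).continuousAt.continuousWithinAt)
      (fun x _ => (hQ x).differentiableAt.differentiableWithinAt) fun x hx => ?_
    rw [(hQ x).deriv]
    exact hp x (interior_subset hx)
  refine ⟨hm, fun x hx => ⟨?_, ?_⟩⟩
  · rw [← h0]; exact hm (left_mem_Icc.2 zero_le_one) hx hx.1
  · rw [← h1]; exact hm hx (right_mem_Icc.2 zero_le_one) hx.2

/-- The dissipation estimate behind the expansion in `L¹`. -/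
theorem kMin_mul_integral_abs_le {K : ℝ → ℝ} {Φ : ℝ} (hK : ContDiff ℝ 2 K)
    {Q₁ Q₂ p₁ p₂ : ℝ → ℝ} (hQ₁ : ∀ x, HasDerivAt Q₁ (p₁ x) x)
    (hQ₂ : ∀ x, HasDerivAt Q₂ (p₂ x) x) (hc₁ : Continuous p₁) (hc₂ : Continuous p₂)
    (hp₁ : ∀ x ∈ Icc (0 : ℝ) 1, 0 ≤ p₁ x) (hp₂ : ∀ x ∈ Icc (0 : ℝ) 1, 0 ≤ p₂ x)
    (h₁0 : Q₁ 0 = 0) (h₂0 : Q₂ 0 = 0) (h₁1 : Q₁ 1 = Φ) (h₂1 : Q₂ 1 = Φ) :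
    kMin K Φ * ∫ x in (0 : ℝ)..1, |p₁ x - p₂ x| ≤
      ∫ x in (0 : ℝ)..1, strictSign (p₁ x - p₂ x) *
        (deriv K (Q₁ x) * p₁ x - deriv K (Q₂ x) * p₂ x) := by
  have hQ₁c : Continuous Q₁ := continuous_iff_continuousAt.2 fun x => (hQ₁ x).continuousAt
  have hQ₂c : Continuous Q₂ := continuous_iff_continuousAt.2 fun x => (hQ₂ x).continuousAt
  obtain ⟨-, hm₁⟩ := mem_Icc_of_deriv_nonneg hQ₁ hp₁ h₁0 h₁1
  obtain ⟨-, hm₂⟩ := mem_Icc_of_deriv_nonneg hQ₂ hp₂ h₂0 h₂1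
  have hK1 : ContDiff ℝ 1 (deriv K) := ((contDiff_succ_iff_deriv (n := 1)).1 hK).2.2
  have hK'c : Continuous (deriv K) := hK1.continuous
  have hK''c : Continuous (deriv (deriv K)) := hK1.continuous_deriv le_rfl
  set A : ℝ → ℝ := fun φ => ∫ t in (0 : ℝ)..φ, max (deriv (deriv K) t) 0 with hA
  set B : ℝ → ℝ := fun φ => ∫ t in φ..Φ, -min (deriv (deriv K) t) 0 with hB
  have hmaxc : Continuous fun t => max (deriv (deriv K) t) 0 := by fun_prop
  have hminc : Continuous fun t => -min (deriv (deriv K) t) 0 := by fun_prop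
  have hmaxi := fun a b => hmaxc.intervalIntegrable (μ := MeasureTheory.volume) a b
  have hmini := fun a b => hminc.intervalIntegrable (μ := MeasureTheory.volume) a b
  have hAc : Continuous A := intervalIntegral.continuous_primitive hmaxi 0
  have hBc : Continuous B := by
    have : B = fun φ => -∫ t in Φ..φ, -min (deriv (deriv K) t) 0 := by
      funext φ; exact intervalIntegral.integral_symm _ _
    rw [this]
    exact (intervalIntegral.continuous_primitive hmini Φ).neg
  have hAm : ∀ u v, u ≤ v → A u ≤ A v := fun u v huv => by
    have h1 : A u + ∫ t in u..v, max (deriv (deriv K) t) 0 = A v :=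
      intervalIntegral.integral_add_adjacent_intervals (hmaxi _ _) (hmaxi _ _)
    have h2 : 0 ≤ ∫ t in u..v, max (deriv (deriv K) t) 0 :=
      intervalIntegral.integral_nonneg huv fun t _ => le_max_right _ _
    linarith
  have hBm : ∀ u v, u ≤ v → B v ≤ B u := fun u v huv => by
    have h1 : (∫ t in u..v, -min (deriv (deriv K) t) 0) + B v = B u :=
      intervalIntegral.integral_add_adjacent_intervals (hmini _ _) (hmini _ _)
    have h2 : 0 ≤ ∫ t in u..v, -min (deriv (deriv K) t) 0 :=
      intervalIntegral.integral_nonneg huv fun t _ => neg_nonneg.2 (min_le_right _ _)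
    linarith
  have hA0 : ∀ u ∈ Icc 0 Φ, 0 ≤ A u := fun u hu => by
    have : A 0 = 0 := intervalIntegral.integral_same
    exact this ▸ hAm 0 u hu.1
  have hB0 : ∀ u ∈ Icc 0 Φ, 0 ≤ B u := fun u hu => by
    have : B Φ = 0 := intervalIntegral.integral_same
    exact this ▸ hBm u Φ hu.2
  have hdec : ∀ φ, deriv K φ = kMin K Φ + A φ + B φ := fun φ => by
    have h1 : ∫ t in (0 : ℝ)..φ, deriv (deriv K) t = deriv K φ - deriv K 0 :=
      intervalIntegral.integral_deriv_eq_sub (fun t _ => hK1.differentiable one_ne_zero t)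
        (hK''c.intervalIntegrable _ _)
    have h2 : (∫ t in (0 : ℝ)..φ, -min (deriv (deriv K) t) 0) + B φ =
        ∫ t in (0 : ℝ)..Φ, -min (deriv (deriv K) t) 0 :=
      intervalIntegral.integral_add_adjacent_intervals (hmini _ _) (hmini _ _)
    have h3 : A φ - (∫ t in (0 : ℝ)..φ, -min (deriv (deriv K) t) 0) =
        ∫ t in (0 : ℝ)..φ, deriv (deriv K) t := by
      rw [← intervalIntegral.integral_sub (hmaxi _ _) (hmini _ _)]
      refine intervalIntegral.integral_congr fun t _ => ?_
      simp only [sub_neg_eq_add, max_add_min, add_zero]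
    have h4 : kMin K Φ = deriv K 0 - ∫ t in (0 : ℝ)..Φ, -min (deriv (deriv K) t) 0 := by
      rw [intervalIntegral.integral_neg, sub_neg_eq_add]; rfl
    linarith
  set e : ℝ → ℝ := fun x => Real.sign (Q₁ x - Q₂ x) with he
  set σ : ℝ → ℝ := fun x => strictSign (p₁ x - p₂ x) with hσ
  have hem : Measurable e := measurable_sign.comp (hQ₁c.sub hQ₂c).measurable
  have hσm : Measurable σ := measurable_strictSign.comp (hc₁.sub hc₂).measurable
  -- The identity is wanted for `B - A`, which may change sign. The constant `c` makes `c + B - A`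
  -- positive on `[0, Φ]`; the identity for the constant rate 1, times `c`, is subtracted
  -- afterwards.
  obtain ⟨c, hc⟩ : ∃ c, c = 1 + A Φ := ⟨_, rfl⟩
  have hcpos : ∀ x ∈ Icc 0 Φ, 0 < c + B x - A x := fun x hx => by
    have := hAm x Φ hx.2
    have := hB0 x hx
    linarith
  have z1 := intervalIntegral_sign_sub_mul_eq_zero (h := fun x => c + B x - A x) (by fun_prop)
    hcpos hQ₁ hQ₂ hc₁ hc₂ hm₁ hm₂ (h₁0.trans h₂0.symm) (h₁1.trans h₂1.symm)
  have z2 := intervalIntegral_sign_sub_mul_eq_zero (h := fun _ => 1) continuous_const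
    (fun _ _ => zero_lt_one) hQ₁ hQ₂ hc₁ hc₂ hm₁ hm₂ (h₁0.trans h₂0.symm) (h₁1.trans h₂1.symm)
  have i1 := intervalIntegrable_bounded_mul hem (fun x => abs_sign_le_one _)
    (f := fun x => (c + B (Q₁ x) - A (Q₁ x)) * p₁ x - (c + B (Q₂ x) - A (Q₂ x)) * p₂ x)
    (by fun_prop) 0 1
  have i2 := intervalIntegrable_bounded_mul hem (fun x => abs_sign_le_one _)
    (f := fun x => 1 * p₁ x - 1 * p₂ x) (by fun_prop) 0 1
  have i3 : IntervalIntegrable (fun x => |p₁ x - p₂ x|) MeasureTheory.volume 0 1 :=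
    (by fun_prop : Continuous fun x => |p₁ x - p₂ x|).intervalIntegrable _ _
  have hlow : kMin K Φ * ∫ x in (0 : ℝ)..1, |p₁ x - p₂ x| = ∫ x in (0 : ℝ)..1,
      (kMin K Φ * |p₁ x - p₂ x| + (e x * ((c + B (Q₁ x) - A (Q₁ x)) * p₁ x -
        (c + B (Q₂ x) - A (Q₂ x)) * p₂ x) - c * (e x * (1 * p₁ x - 1 * p₂ x)))) := by
    rw [intervalIntegral.integral_add (i3.const_mul _) (i1.sub (i2.const_mul c)),
      intervalIntegral.integral_sub i1 (i2.const_mul c), intervalIntegral.integral_const_mul,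
      intervalIntegral.integral_const_mul, z1, z2]
    ring
  rw [hlow]
  refine intervalIntegral.integral_mono_on zero_le_one
    ((i3.const_mul _).add (i1.sub (i2.const_mul c)))
    (intervalIntegrable_bounded_mul hσm (fun x => (abs_strictSign _).le) (by fun_prop) 0 1)
    fun x hx => ?_
  have hm1 := hm₁ x hx
  have hm2 := hm₂ x hx
  have k1 := neg_sign_mul_le_of_monotone (u := Q₁ x) (v := Q₂ x) (hA0 _ hm1) (hA0 _ hm2)
    (hp₁ x hx) (hp₂ x hx) (hAm _ _) (hAm _ _)
  have k2 := sign_mul_le_of_antitone (u := Q₁ x) (v := Q₂ x) (hB0 _ hm1) (hB0 _ hm2)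
    (hp₁ x hx) (hp₂ x hx) (hBm _ _) (hBm _ _)
  have k3 := strictSign_mul_self (p₁ x - p₂ x)
  rw [hdec (Q₁ x), hdec (Q₂ x), ← k3]
  simp only [he]
  linear_combination k1 + k2

/-! ### Exponential expansion in `L¹` -/

theorem integral_eq_mul_integral_comp_sub_mul (f : ℝ → ℝ) (h : ℝ) :
    ∫ x in (1 - h)..1, f x = h * ∫ θ in (0 : ℝ)..1, f (1 - h * θ) := by
  simp

theorem integral_eq_mul_integral_comp_mul (f : ℝ → ℝ) (h : ℝ) :
    ∫ x in (0 : ℝ)..h, f x = h * ∫ θ in (0 : ℝ)..1, f (h * θ) := by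
  simp

/-- Lower right Dini derivative of the `L¹` norm of a function transported with unit speed on the
circle, with source `D`. -/
theorem exists_slope_lower_bound {W D : ℝ → ℝ → ℝ} (hW : Continuous fun x : ℝ × ℝ => W x.1 x.2)
    (hD : Continuous fun x : ℝ × ℝ => D x.1 x.2) {τ : ℝ}
    (hWD : ∀ r, τ ≤ r → ∀ x, HasDerivAt (fun r => W r (x + r)) (D r (x + r)) r)
    (hper : W τ 0 = W τ 1) :
    ∃ ψ : ℝ → ℝ, Continuous ψ ∧ ψ 0 = 0 ∧ ∀ h ∈ Icc (0 : ℝ) 1,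
      h * ((∫ x in (0 : ℝ)..1, strictSign (W τ x) * D τ x) + ψ h) ≤
        (∫ x in (0 : ℝ)..1, |W (τ + h) x|) - ∫ x in (0 : ℝ)..1, |W τ x| := by
  set M : ℝ → ℝ → ℝ := fun h η => ∫ θ in (0 : ℝ)..1, D (τ + h * θ) (η + h * θ) with hM
  have hMc : Continuous fun x : ℝ × ℝ => M x.1 x.2 :=
    intervalIntegral.continuous_parametric_intervalIntegral_of_continuous'
      (f := fun (x : ℝ × ℝ) θ => D (τ + x.1 * θ) (x.2 + x.1 * θ))
      (hD.comp (by fun_prop : Continuous fun z : (ℝ × ℝ) × ℝ =>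
        (τ + z.1.1 * z.2, z.1.2 + z.1.1 * z.2))) 0 1
  have hM0 : ∀ η, M 0 η = D τ η := fun η => by simp [hM]
  have hMW : ∀ h, 0 ≤ h → ∀ η, W (τ + h) (η + h) = W τ η + h * M h η := by
    intro h hh η
    have h1 : ∀ r ∈ uIcc τ (τ + h), HasDerivAt (fun r => W r (η - τ + r)) (D r (η - τ + r)) r :=
      fun r hr => by
        rw [uIcc_of_le (by linarith)] at hr
        exact hWD r hr.1 _
    have h2 : Continuous fun r => D r (η - τ + r) :=
      hD.comp (by fun_prop : Continuous fun r : ℝ => (r, η - τ + r))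
    have h3 := intervalIntegral.integral_eq_sub_of_hasDerivAt h1 (h2.intervalIntegrable _ _)
    have h4 := intervalIntegral.mul_integral_comp_add_mul (a := (0 : ℝ)) (b := 1)
      (f := fun r => D r (η - τ + r)) h τ
    simp only [mul_zero, add_zero, mul_one] at h4
    rw [← h4] at h3
    have h5 : (fun θ : ℝ => D (τ + h * θ) (η - τ + (τ + h * θ))) =
        fun θ => D (τ + h * θ) (η + h * θ) := by
      funext θ; congr 1; ring
    rw [h5] at h3
    rw [show η - τ + (τ + h) = η + h by ring, show η - τ + τ = η by ring] at h3
    simp only [hM]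
    linarith
  have cont : ∀ g : ℝ × ℝ → ℝ, Continuous g → Continuous fun h => ∫ θ in (0 : ℝ)..1, g (h, θ) :=
    fun g hg => intervalIntegral.continuous_parametric_intervalIntegral_of_continuous'
      (f := fun h θ => g (h, θ)) hg 0 1
  have c1 := cont (fun x => |W (τ + x.1) (x.1 * x.2)|) (hW.comp (by fun_prop : Continuous
    fun x : ℝ × ℝ => (τ + x.1, x.1 * x.2))).abs
  have c2 := cont (fun x => |W τ (1 - x.1 * x.2)|) (hW.comp (by fun_prop : Continuous
    fun x : ℝ × ℝ => (τ, 1 - x.1 * x.2))).abs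
  have c3 := cont (fun x => |M x.1 (1 - x.1 * x.2)|) (hMc.comp (by fun_prop : Continuous
    fun x : ℝ × ℝ => (x.1, 1 - x.1 * x.2))).abs
  have c4 := cont (fun x => |M x.1 x.2 - M 0 x.2|) (hMc.sub (hMc.comp (by fun_prop : Continuous
    fun x : ℝ × ℝ => ((0 : ℝ), x.2)))).abs
  -- The error has three sources: inflow minus outflow through the strips of width `h`, which cancel
  -- at `h = 0` by `hper`; the source in the outgoing strip; and the variation of the averaged
  -- source `M`.
  refine ⟨fun h => (∫ θ in (0 : ℝ)..1, |W (τ + h) (h * θ)|) -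
    (∫ θ in (0 : ℝ)..1, |W τ (1 - h * θ)|) - h * (∫ θ in (0 : ℝ)..1, |M h (1 - h * θ)|) -
    ∫ θ in (0 : ℝ)..1, |M h θ - M 0 θ|, ?_, ?_, ?_⟩
  · exact ((c1.sub c2).sub (continuous_id.mul c3)).sub c4
  · simp [hper]
  · intro h hh
    have hWτ : ∀ t, Continuous (W t) := fun t =>
      hW.comp (by fun_prop : Continuous fun x : ℝ => (t, x))
    have hMh : ∀ t, Continuous (M t) := fun t =>
      hMc.comp (by fun_prop : Continuous fun x : ℝ => (t, x))
    set σ : ℝ → ℝ := fun x => strictSign (W τ x) with hσ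
    have hσm : Measurable σ := measurable_strictSign.comp (hWτ τ).measurable
    have hσi : ∀ f : ℝ → ℝ, Continuous f → ∀ a b,
        IntervalIntegrable (fun x => σ x * f x) MeasureTheory.volume a b := fun f hf a b =>
      intervalIntegrable_bounded_mul hσm (fun x => (abs_strictSign _).le) hf a b
    have hi : ∀ f : ℝ → ℝ, Continuous f → ∀ a b,
        IntervalIntegrable f MeasureTheory.volume a b := fun f hf a b => hf.intervalIntegrable a b
    have e1 := intervalIntegral.integral_add_adjacent_intervals
      (hi _ (hWτ (τ + h)).abs 0 h) (hi _ (hWτ (τ + h)).abs h 1)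
    have e2 := intervalIntegral.integral_add_adjacent_intervals
      (hi _ (hWτ τ).abs 0 (1 - h)) (hi _ (hWτ τ).abs (1 - h) 1)
    have e3 := integral_eq_mul_integral_comp_mul (fun x => |W (τ + h) x|) h
    have e4 := integral_eq_mul_integral_comp_sub_mul (fun x => |W τ x|) h
    have e5 := integral_eq_mul_integral_comp_sub_mul (fun x => |M h x|) h
    have e6 := intervalIntegral.integral_comp_add_right (a := (0 : ℝ)) (b := 1 - h)
      (fun x => |W (τ + h) x|) h
    rw [zero_add, sub_add_cancel] at e6
    -- Transport carries `[0, 1 - h]` to `[h, 1]`, and `|w + h m| ≥ |w| + h σ m` for a sign `σ` of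
    -- `w`.
    have e7 : (∫ x in (0 : ℝ)..(1 - h), |W τ x|) + h * (∫ x in (0 : ℝ)..(1 - h), σ x * M h x) ≤
        ∫ x in (0 : ℝ)..(1 - h), |W (τ + h) (x + h)| := by
      rw [← intervalIntegral.integral_const_mul, ← intervalIntegral.integral_add
        (hi _ (hWτ τ).abs _ _) ((hσi _ (hMh h) _ _).const_mul h)]
      refine intervalIntegral.integral_mono_on (by linarith [hh.2])
        ((hi _ (hWτ τ).abs _ _).add ((hσi _ (hMh h) _ _).const_mul h))
        (hi _ ((hWτ (τ + h)).comp (by fun_prop : Continuous fun x : ℝ => x + h)).abs _ _)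
        fun x _ => ?_
      rw [hMW h hh.1 x]
      refine le_trans (le_of_eq ?_) (strictSign_mul_le (W τ x) _)
      rw [mul_add, strictSign_mul_self]
      simp only [hσ]
      ring
    have e8 := intervalIntegral.integral_add_adjacent_intervals
      (hσi _ (hMh h) 0 (1 - h)) (hσi _ (hMh h) (1 - h) 1)
    have e9 : ∫ x in (1 - h)..1, σ x * M h x ≤ ∫ x in (1 - h)..1, |M h x| :=
      intervalIntegral.integral_mono_on (by linarith [hh.1]) (hσi _ (hMh h) _ _)
        (hi _ (hMh h).abs _ _) fun x _ => strictSign_mul_le _ _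
    have e10 : (∫ x in (0 : ℝ)..1, σ x * D τ x) - (∫ x in (0 : ℝ)..1, |M h x - M 0 x|) ≤
        ∫ x in (0 : ℝ)..1, σ x * M h x := by
      have hD' : Continuous (D τ) := hD.comp (by fun_prop : Continuous fun x : ℝ => (τ, x))
      rw [← intervalIntegral.integral_sub (hσi _ hD' _ _)
        (hi (fun x => |M h x - M 0 x|) ((hMh h).sub (hMh 0)).abs _ _)]
      refine intervalIntegral.integral_mono_on zero_le_one
        ((hσi _ hD' _ _).sub (hi (fun x => |M h x - M 0 x|) ((hMh h).sub (hMh 0)).abs _ _)) (hσi _ (hMh h) _ _)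
        fun x _ => ?_
      have h1 := strictSign_mul_le (W τ x) (-(M h x - M 0 x))
      rw [abs_neg, hM0] at h1
      rw [hM0]
      simp only [hσ]
      linarith
    have e11 : h * ((∫ x in (0 : ℝ)..1, σ x * D τ x) - (∫ x in (0 : ℝ)..1, |M h x - M 0 x|) -
        h * ∫ θ in (0 : ℝ)..1, |M h (1 - h * θ)|) ≤ h * ∫ x in (0 : ℝ)..(1 - h), σ x * M h x :=
      mul_le_mul_of_nonneg_left (by linarith) hh.1
    linarith

/-- Expansion in `L¹`: the distance of the derivatives of two relaxed solutions that are
nondecreasing grows at least exponentially. -/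
theorem IsRelaxedSolution.integral_abs_sub_ge {K : ℝ → ℝ} {Φ : ℝ}
    (hK : ContDiff ℝ 2 K) {q₁ q₂ s₁ s₂ : ℝ → ℝ} {Q₁ Q₂ p₁ p₂ : ℝ → ℝ → ℝ}
    (h₁ : IsRelaxedSolution K Φ q₁ Q₁ p₁ s₁) (h₂ : IsRelaxedSolution K Φ q₂ Q₂ p₂ s₂) {b : ℝ}
    (hb : 0 ≤ b) (hp₁ : ∀ τ ∈ Ico 0 b, ∀ x ∈ Icc (0 : ℝ) 1, 0 ≤ p₁ τ x)
    (hp₂ : ∀ τ ∈ Ico 0 b, ∀ x ∈ Icc (0 : ℝ) 1, 0 ≤ p₂ τ x)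
    (hper : ∀ τ ∈ Ico 0 b, p₁ τ 0 - p₂ τ 0 = p₁ τ 1 - p₂ τ 1) :
    (∫ x in (0 : ℝ)..1, |p₁ 0 x - p₂ 0 x|) * Real.exp (kMin K Φ * b) ≤
      ∫ x in (0 : ℝ)..1, |p₁ b x - p₂ b x| := by
  have hK'c : Continuous (deriv K) := hK.continuous_deriv one_le_two
  have hc₁ := h₁.continuous_deriv
  have hc₂ := h₂.continuous_deriv
  have hQc₁ := h₁.contDiff.continuous
  have hQc₂ := h₂.contDiff.continuous
  set W : ℝ → ℝ → ℝ := fun τ x => p₁ τ x - p₂ τ x with hW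
  set D : ℝ → ℝ → ℝ := fun τ x => deriv K (Q₁ τ x) * p₁ τ x - deriv K (Q₂ τ x) * p₂ τ x with hD
  have hWc : Continuous fun x : ℝ × ℝ => W x.1 x.2 := hc₁.sub hc₂
  have hDc : Continuous fun x : ℝ × ℝ => D x.1 x.2 := by
    simp only [hD]; fun_prop
  set L : ℝ → ℝ := fun τ => ∫ x in (0 : ℝ)..1, |W τ x| with hL
  have hLc : Continuous L :=
    intervalIntegral.continuous_parametric_intervalIntegral_of_continuous'
      (f := fun τ x => |W τ x|) hWc.abs 0 1
  -- Grönwall's inequality bounds from above, so it is applied to `-L`.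
  have key := le_gronwallBound_of_liminf_deriv_right_le (f := fun τ => -L τ)
    (f' := fun τ => -(kMin K Φ * L τ)) (δ := -L 0) (K := kMin K Φ) (ε := 0) (a := 0) (b := b)
    hLc.neg.continuousOn ?_ le_rfl (fun τ _ => by simp) b (right_mem_Icc.2 hb)
  · rw [gronwallBound_ε0, sub_zero] at key
    show L 0 * _ ≤ L b
    linarith
  · intro τ hτ r hr
    have hsl : ∀ t : ℝ, Continuous fun x : ℝ => (t, x) := fun t => by fun_prop
    obtain ⟨ψ, hψc, hψ0, hψ⟩ := exists_slope_lower_bound hWc hDc (τ := τ)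
      (fun t ht x => (h₁.hasDerivAt_char t (hτ.1.trans ht) x).sub
        (h₂.hasDerivAt_char t (hτ.1.trans ht) x)) (hper τ hτ)
    have hkm := kMin_mul_integral_abs_le hK (h₁.hasDerivAt_right τ) (h₂.hasDerivAt_right τ)
      (hc₁.comp (hsl τ)) (hc₂.comp (hsl τ)) (hp₁ τ hτ) (hp₂ τ hτ) (h₁.left τ hτ.1)
      (h₂.left τ hτ.1) (h₁.right τ hτ.1) (h₂.right τ hτ.1)
    refine Eventually.frequently ?_
    have hev : ∀ᶠ z in 𝓝[>] τ, -(kMin K Φ * L τ) - ψ (z - τ) < r := by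
      have hc : Continuous fun z => -(kMin K Φ * L τ) - ψ (z - τ) := by fun_prop
      refine nhdsWithin_le_nhds (hc.continuousAt.eventually_lt continuousAt_const ?_)
      simpa [hψ0] using hr
    filter_upwards [hev, Ioo_mem_nhdsGT (show τ < τ + 1 by linarith)] with z hz hzτ
    have hz0 : 0 < z - τ := sub_pos.2 hzτ.1
    have h3 := hψ (z - τ) ⟨hz0.le, by linarith [hzτ.2]⟩
    rw [add_sub_cancel] at h3
    rw [inv_mul_lt_iff₀ hz0]
    have h4 : (z - τ) * (kMin K Φ * L τ + ψ (z - τ)) ≤ L z - L τ :=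
      (mul_le_mul_of_nonneg_left (add_le_add_left hkm _) hz0.le).trans h3
    have h5 := mul_lt_mul_of_pos_left hz hz0
    linarith

/-! ### Existence and uniqueness of the steady state -/

/-- The phase `φ = g η` as a new variable turns `∫ dη = 1` into the crossing-time condition. -/
theorem integral_one_div_add_eq_one {K g : ℝ → ℝ} {Φ c : ℝ} (hK : Continuous K)
    (hpos : ∀ x ∈ Icc 0 Φ, 0 < K x) (hc : 0 ≤ c)
    (hg : ∀ η ∈ Icc (0 : ℝ) 1, HasDerivAt g (c + K (g η)) η) (h0 : g 0 = 0) (h1 : g 1 = Φ)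
    (hm : ∀ η ∈ Icc (0 : ℝ) 1, g η ∈ Icc 0 Φ) : ∫ φ in (0 : ℝ)..Φ, 1 / (c + K φ) = 1 := by
  have hgc : ContinuousOn g (Icc 0 1) := fun η hη => (hg η hη).continuousAt.continuousWithinAt
  have huI : uIcc (0 : ℝ) 1 = Icc 0 1 := uIcc_of_le zero_le_one
  have hne : ∀ η ∈ Icc (0 : ℝ) 1, c + K (g η) ≠ 0 := fun η hη =>
    (add_pos_of_nonneg_of_pos hc (hpos _ (hm η hη))).ne'
  have := intervalIntegral.integral_comp_mul_deriv' (a := (0 : ℝ)) (b := 1) (f := g)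
    (f' := fun η => c + K (g η)) (g := fun φ => 1 / (c + K φ)) (by rwa [huI])
    (by rw [huI]; exact continuousOn_const.add (hK.comp_continuousOn hgc))
    (by
      rw [huI]
      refine continuousOn_const.div (by fun_prop) ?_
      rintro _ ⟨η, hη, rfl⟩
      exact hne η hη)
  rw [h0, h1] at this
  rw [← this]
  have h2 : ∫ x in (0 : ℝ)..1, ((fun φ => 1 / (c + K φ)) ∘ g) x * (c + K (g x)) =
      ∫ _x in (0 : ℝ)..1, (1 : ℝ) := by
    refine intervalIntegral.integral_congr fun η hη => ?_
    rw [huI] at hη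
    exact one_div_mul_cancel (hne η hη)
  rw [h2]
  simp

theorem integral_one_div_add_lt {K : ℝ → ℝ} {Φ c c' : ℝ} (hΦ : 0 < Φ) (hK : Continuous K)
    (hpos : ∀ x ∈ Icc 0 Φ, 0 < K x) (hc : 0 ≤ c) (hcc : c < c') :
    ∫ φ in (0 : ℝ)..Φ, 1 / (c' + K φ) < ∫ φ in (0 : ℝ)..Φ, 1 / (c + K φ) := by
  have hp : ∀ φ ∈ Icc 0 Φ, 0 < c + K φ := fun φ hφ =>
    add_pos_of_nonneg_of_pos hc (hpos φ hφ)
  have hlt : ∀ φ ∈ Icc 0 Φ, 1 / (c' + K φ) < 1 / (c + K φ) := fun φ hφ =>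
    one_div_lt_one_div_of_lt (hp φ hφ) (by linarith)
  refine intervalIntegral.integral_lt_integral_of_continuousOn_of_le_of_exists_lt hΦ
    (continuousOn_const.div (by fun_prop) fun φ hφ => ?_)
    (continuousOn_const.div (by fun_prop) fun φ hφ => (hp φ hφ).ne')
    (fun φ hφ => (hlt φ (Ioc_subset_Icc_self hφ)).le)
    ⟨0, left_mem_Icc.2 hΦ.le, hlt 0 (left_mem_Icc.2 hΦ.le)⟩
  have := hp φ hφ
  exact (by linarith : 0 < c' + K φ).ne'

/-- Existence of the steady profile: the solution of `g' = c + K g` that crosses `[0, ΦF]` in a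
unit of time, for a suitable `c > 0`. -/
theorem exists_steadyProfile {K : ℝ → ℝ} {Φ : ℝ} (hΦ : 0 < Φ) (hK : Continuous K)
    (hpos : ∀ x ∈ Icc 0 Φ, 0 < K x) (hss : 1 < ∫ φ in (0 : ℝ)..Φ, 1 / K φ) :
    ∃ (c : ℝ) (g : ℝ → ℝ), 0 < c ∧ ContDiff ℝ 1 g ∧ g 0 = 0 ∧ g 1 = Φ ∧
      (∀ η ∈ Icc (0 : ℝ) 1, g η ∈ Icc 0 Φ) ∧
      ∀ η ∈ Icc (0 : ℝ) 1, HasDerivAt g (c + K (g η)) η := by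
  -- Outside `[0, Φ]` the sign of `K` is unknown; clamping the argument keeps the rate positive on
  -- the whole line.
  set κ : ℝ → ℝ := fun φ => K (projIcc 0 Φ hΦ.le φ) with hκ
  have hκc : Continuous κ := hK.comp (continuous_subtype_val.comp continuous_projIcc)
  have hκp : ∀ φ, 0 < κ φ := fun φ => hpos _ (projIcc 0 Φ hΦ.le φ).2
  have hκe : ∀ φ ∈ Icc 0 Φ, κ φ = K φ := fun φ hφ => by simp only [hκ, projIcc_of_mem _ hφ]
  have huI : uIcc 0 Φ = Icc 0 Φ := uIcc_of_le hΦ.le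
  -- The crossing time exceeds 1 at `c = 0` and is at most 1 at `c = Φ`, because the speed is then
  -- at least `Φ`.
  obtain ⟨c, hc0, hc1⟩ : ∃ c, 0 < c ∧ ∫ φ in (0 : ℝ)..Φ, 1 / (c + κ φ) = 1 := by
    set f : ℝ → ℝ := fun c => ∫ φ in (0 : ℝ)..Φ, 1 / (max c 0 + κ φ) with hf
    have hne : ∀ c φ, 0 < max c 0 + κ φ := fun c φ =>
      add_pos_of_nonneg_of_pos (le_max_right _ _) (hκp φ)
    have hfc : Continuous f := by
      refine intervalIntegral.continuous_parametric_intervalIntegral_of_continuous'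
        (f := fun c φ => 1 / (max c 0 + κ φ)) ?_ 0 Φ
      exact continuous_const.div (by fun_prop) fun x => (hne x.1 x.2).ne'
    have hf0 : 1 < f 0 := by
      refine hss.trans_eq (intervalIntegral.integral_congr fun φ hφ => ?_)
      rw [huI] at hφ
      simp only [max_self, zero_add, hκe φ hφ]
    have hf1 : f Φ ≤ 1 := by
      have h1 : f Φ ≤ ∫ _φ in (0 : ℝ)..Φ, 1 / Φ := by
        refine intervalIntegral.integral_mono_on hΦ.le ?_ (by simp) fun φ _ => ?_
        · exact (continuous_const.div (by fun_prop) fun x => (hne Φ x).ne').intervalIntegrable _ _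
        · refine one_div_le_one_div_of_le hΦ ?_
          rw [max_eq_left hΦ.le]
          linarith [hκp φ]
      refine h1.trans_eq ?_
      rw [intervalIntegral.integral_const, sub_zero, smul_eq_mul, mul_one_div_cancel hΦ.ne']
    obtain ⟨c, hc, hfcc⟩ := intermediate_value_Icc' hΦ.le hfc.continuousOn ⟨hf1, hf0.le⟩
    have hcpos : 0 < c := by
      refine hc.1.lt_of_ne fun h => ?_
      rw [← h] at hfcc
      linarith
    exact ⟨c, hcpos, by simpa only [hf, max_eq_left hc.1] using hfcc⟩
  have hp : ∀ φ, 0 < c + κ φ := fun φ => add_pos hc0 (hκp φ)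
  have hic : Continuous fun φ => 1 / (c + κ φ) :=
    continuous_const.div (by fun_prop) fun x => (hp x).ne'
  set H : ℝ → ℝ := fun x => ∫ φ in (0 : ℝ)..x, 1 / (c + κ φ) with hH
  have hHd : ∀ x, HasDerivAt H (1 / (c + κ x)) x := fun x =>
    intervalIntegral.integral_hasDerivAt_right (hic.intervalIntegrable 0 x)
      hic.stronglyMeasurable.stronglyMeasurableAtFilter hic.continuousAt
  have hHm : StrictMono H := strictMono_of_deriv_pos fun x => by
    rw [(hHd x).deriv]; exact one_div_pos.2 (hp x)
  have hHc : Continuous H := continuous_iff_continuousAt.2 fun x => (hHd x).continuousAt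
  have hH0 : H 0 = 0 := intervalIntegral.integral_same
  obtain ⟨B, hB⟩ := (isCompact_Icc (a := 0) (b := Φ)).exists_bound_of_continuousOn
    hK.continuousOn
  have hκB : ∀ φ, κ φ ≤ B := fun φ => (le_abs_self _).trans (hB _ (projIcc 0 Φ hΦ.le φ).2)
  have hB0 : 0 < c + B := (hp 0).trans_le (by linarith [hκB 0])
  have hsurj : Function.Surjective H := by
    have hd : ∀ x, HasDerivAt (fun x => H x - 1 / (c + B) * x) (1 / (c + κ x) - 1 / (c + B)) x :=
      fun x => by
        simpa using! (hHd x).sub ((hasDerivAt_id x).const_mul (1 / (c + B)))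
    have hmono : Monotone fun x => H x - 1 / (c + B) * x :=
      monotone_of_deriv_nonneg (fun x => (hd x).differentiableAt) fun x => by
        rw [(hd x).deriv, sub_nonneg]
        exact one_div_le_one_div_of_le (hp x) (by linarith [hκB x])
    have hi : 0 < 1 / (c + B) := one_div_pos.2 hB0
    refine hHc.surjective ?_ ?_
    · refine tendsto_atTop_mono' _ ?_ (tendsto_id.const_mul_atTop hi)
      filter_upwards [eventually_ge_atTop 0] with x hx
      have := hmono hx
      simp only [hH0, mul_zero, sub_zero] at this
      simpa using this
    · refine tendsto_atBot_mono' _ ?_ (tendsto_id.const_mul_atBot hi)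
      filter_upwards [eventually_le_atBot 0] with x hx
      have := hmono hx
      simp only [hH0, mul_zero, sub_zero] at this
      simpa using this
  set e := (hHm.orderIsoOfSurjective H hsurj).toHomeomorph with he
  have heH : ∀ x, e x = H x := fun x => rfl
  have hgH : ∀ y, H (e.symm y) = y := fun y => e.apply_symm_apply y
  have hgm : StrictMono e.symm := (hHm.orderIsoOfSurjective H hsurj).symm.strictMono
  have hgd : ∀ y, HasDerivAt e.symm (c + κ (e.symm y)) y := fun y => by
    have := HasDerivAt.of_local_left_inverse (f := H) (g := e.symm) (a := y)
      e.symm.continuous.continuousAt (hHd _) (one_div_pos.2 (hp _)).ne'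
      (Eventually.of_forall hgH)
    simpa using this
  have h0 : e.symm 0 = 0 := by
    have := e.symm_apply_apply 0
    rwa [heH, hH0] at this
  have h1 : e.symm 1 = Φ := by
    rw [← hc1]; exact e.symm_apply_apply Φ
  have hm : ∀ η ∈ Icc (0 : ℝ) 1, e.symm η ∈ Icc 0 Φ := fun η hη =>
    ⟨by rw [← h0]; exact hgm.monotone hη.1, by rw [← h1]; exact hgm.monotone hη.2⟩
  refine ⟨c, e.symm, hc0, ?_, h0, h1, hm, fun η hη => ?_⟩
  · refine contDiff_one_iff_deriv.2 ⟨fun y => (hgd y).differentiableAt, ?_⟩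
    rw [show deriv e.symm = fun y => c + κ (e.symm y) from funext fun y => (hgd y).deriv]
    have := e.symm.continuous
    fun_prop
  · rw [← hκe _ (hm η hη)]
    exact hgd η

theorem mem_Icc_of_monotoneOn {q : ℝ → ℝ} {Φ : ℝ} (hq : MonotoneOn q (Icc 0 1)) (h0 : q 0 = 0)
    (h1 : q 1 = Φ) {η : ℝ} (hη : η ∈ Icc (0 : ℝ) 1) : q η ∈ Icc 0 Φ := by
  constructor
  · rw [← h0]; exact hq (left_mem_Icc.2 zero_le_one) hη hη.1
  · rw [← h1]; exact hq hη (right_mem_Icc.2 zero_le_one) hη.2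

theorem isSteadyState_of_eqOn {K g q : ℝ → ℝ} {Φ c : ℝ} (hpos : ∀ x ∈ Icc 0 Φ, 0 < K x)
    (hc : 0 < c) (hgC : ContDiff ℝ 1 g) (h0 : g 0 = 0) (h1 : g 1 = Φ)
    (hm : ∀ η ∈ Icc (0 : ℝ) 1, g η ∈ Icc 0 Φ)
    (hg : ∀ η ∈ Icc (0 : ℝ) 1, HasDerivAt g (c + K (g η)) η) (hq : EqOn q g (Icc 0 1)) :
    IsSteadyState K Φ q := by
  have hz : (0 : ℝ) ∈ Icc (0 : ℝ) 1 := left_mem_Icc.2 zero_le_one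
  have ho : (1 : ℝ) ∈ Icc (0 : ℝ) 1 := right_mem_Icc.2 zero_le_one
  have hqC : ContDiffOn ℝ 1 q (Icc 0 1) := hgC.contDiffOn.congr hq
  have hqd : ∀ η ∈ Icc (0 : ℝ) 1, dEta q η = c + K (q η) := fun η hη => by
    rw [dEta, derivWithin_congr hq (hq hη), hq hη]
    exact (hg η hη).hasDerivWithinAt.derivWithin (uniqueDiffOn_Icc zero_lt_one η hη)
  have hmono : MonotoneOn q (Icc 0 1) := by
    refine MonotoneOn.congr ?_ hq.symm
    refine monotoneOn_of_deriv_nonneg (convex_Icc 0 1) hgC.continuous.continuousOn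
      (hgC.differentiable one_ne_zero).differentiableOn fun η hη => ?_
    have hη' := interior_subset hη
    rw [(hg η hη').deriv]
    exact (add_pos hc (hpos _ (hm η hη'))).le
  have hq1 : q 1 = Φ := by rw [hq ho, h1]
  have hlt : K Φ < dEta q 1 := by rw [hqd 1 ho, hq1]; linarith
  refine ⟨1 / c, ⟨⟨hqC, hmono, by rw [hq hz, h0], hq1, hlt⟩, EReal.zero_lt_top, ?_,
    fun _ _ => hmono, continuousOn_const, fun _ _ => one_div_pos.2 hc, fun τ _ η hη => ?_,
    fun _ _ => by rw [hq hz, h0], fun _ _ => ?_, fun _ _ => rfl, fun _ _ => hlt⟩⟩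
  · exact hqC.comp contDiffOn_snd fun x hx => hx.2
  · rw [hqd η hη, one_div_one_div]
    simp [dTau]
  · rw [hqd 1 ho, hq1, one_div_one_div]
    ring

/-- The crossing time is strictly decreasing in the constant input, so `1 / N = c`; uniqueness for
the scalar equation then identifies the profiles. -/
theorem IsSteadyState.eqOn_profile {K g q : ℝ → ℝ} {Φ c C : ℝ} (hΦ : 0 < Φ) (hKc : Continuous K)
    (hC0 : 0 ≤ C) (hC : ∀ x y, |K x - K y| ≤ C * |x - y|)
    (hpos : ∀ x ∈ Icc 0 Φ, 0 < K x) (hc : 0 < c) (h0 : g 0 = 0) (h1 : g 1 = Φ)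
    (hm : ∀ η ∈ Icc (0 : ℝ) 1, g η ∈ Icc 0 Φ)
    (hg : ∀ η ∈ Icc (0 : ℝ) 1, HasDerivAt g (c + K (g η)) η) (hq : IsSteadyState K Φ q) :
    EqOn q g (Icc 0 1) := by
  have hz : (0 : ℝ) ∈ Icc (0 : ℝ) 1 := left_mem_Icc.2 zero_le_one
  have ho : (1 : ℝ) ∈ Icc (0 : ℝ) 1 := right_mem_Icc.2 zero_le_one
  obtain ⟨N, hN⟩ := hq
  have hT : (0 : ℝ) ∈ timeInterval ⊤ := ⟨le_rfl, EReal.coe_lt_top 0⟩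
  have hNpos : 0 < 1 / N := one_div_pos.2 (hN.rate_pos 0 hT)
  obtain ⟨f, hfC, hfq, hfd⟩ := exists_contDiff_extension hN.data.contDiffOn
  have hf : ∀ η ∈ Icc (0 : ℝ) 1, HasDerivAt f (1 / N + K (f η)) η := fun η hη => by
    have h2 := hN.equation 0 hT η hη
    have h3 : dTau (fun _ => q) 0 η = 0 := by simp [dTau]
    rw [h3, zero_add] at h2
    rw [hfq hη, ← h2, dEta, ← hfd η hη]
    exact (hfC.differentiable one_ne_zero η).hasDerivAt
  have hf0 : f 0 = 0 := by rw [hfq hz, hN.data.map_zero]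
  have hf1 : f 1 = Φ := by rw [hfq ho, hN.data.map_one]
  have hfm : ∀ η ∈ Icc (0 : ℝ) 1, f η ∈ Icc 0 Φ := fun η hη => by
    rw [hfq hη]
    exact mem_Icc_of_monotoneOn hN.data.monotoneOn hN.data.map_zero hN.data.map_one hη
  have e1 := integral_one_div_add_eq_one hKc hpos hNpos.le hf hf0 hf1 hfm
  have e2 := integral_one_div_add_eq_one hKc hpos hc.le hg h0 h1 hm
  have hcN : 1 / N = c := by
    rcases lt_trichotomy (1 / N) c with h | h | h
    · have := integral_one_div_add_lt hΦ hKc hpos hNpos.le h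
      linarith
    · exact h
    · have := integral_one_div_add_lt hΦ hKc hpos hc.le h
      linarith
  rw [hcN] at hf
  have hfg : EqOn f g (Icc 0 1) := ODE_solution_unique (v := fun _ y => c + K y)
    (K := C.toNNReal) (fun _ => LipschitzWith.of_dist_le_mul fun x y => by
      rw [dist_add_left]; exact (lipschitzWith_of_abs_sub_le hC0 hC).dist_le_mul x y)
    (fun η hη => (hf η hη).continuousAt.continuousWithinAt)
    (fun η hη => (hf η (Ico_subset_Icc_self hη)).hasDerivWithinAt)
    (fun η hη => (hg η hη).continuousAt.continuousWithinAt)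
    (fun η hη => (hg η (Ico_subset_Icc_self hη)).hasDerivWithinAt) (by rw [hf0, h0])
  exact hfq.symm.trans hfg

/-! ### Boundary values, positivity and blow-up of relaxed solutions -/

namespace IsRelaxedSolution

variable {K : ℝ → ℝ} {Φ : ℝ} {q : ℝ → ℝ} {Q p : ℝ → ℝ → ℝ} {s : ℝ → ℝ}

theorem hasDerivWithinAt_eq_zero_of_const (h : IsRelaxedSolution K Φ q Q p s) {η c : ℝ}
    (hc : ∀ τ, 0 ≤ τ → Q τ η = c) {τ : ℝ} (hτ : 0 ≤ τ) : s τ + K c - p τ η = 0 := by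
  have h1 := (h.hasDerivAt_left τ hτ η).hasDerivWithinAt (s := Ici 0)
  have h2 : HasDerivWithinAt (fun r => Q r η) 0 (Ici 0) τ :=
    (hasDerivWithinAt_const τ (Ici 0) c).congr hc (hc τ hτ)
  rw [hc τ hτ] at h1
  exact (uniqueDiffOn_Ici 0 τ hτ).eq_deriv _ h1 h2

theorem input_eq_left (h : IsRelaxedSolution K Φ q Q p s) {τ : ℝ} (hτ : 0 ≤ τ) :
    p τ 0 = s τ + K 0 := by
  linarith [h.hasDerivWithinAt_eq_zero_of_const h.left hτ]

theorem input_eq_right (h : IsRelaxedSolution K Φ q Q p s) {τ : ℝ} (hτ : 0 ≤ τ) :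
    p τ 1 = s τ + K Φ := by
  linarith [h.hasDerivWithinAt_eq_zero_of_const h.right hτ]

theorem dEta_eq (h : IsRelaxedSolution K Φ q Q p s) (τ : ℝ) {η : ℝ} (hη : η ∈ Icc (0 : ℝ) 1)
    {f : ℝ → ℝ} (hf : EqOn f (Q τ) (Icc 0 1)) : dEta f η = p τ η := by
  rw [dEta, derivWithin_congr hf (hf hη)]
  exact (h.hasDerivAt_right τ η).hasDerivWithinAt.derivWithin
    (uniqueDiffOn_Icc zero_lt_one η hη)

/-- The sign of `p` is constant along characteristics. Each one comes from the initial profile or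
from `η = 0`, where `p = s + K 0`. -/
theorem deriv_nonneg (h : IsRelaxedSolution K Φ q Q p s) (hK0 : 0 ≤ K 0)
    (hp : ∀ η ∈ Icc (0 : ℝ) 1, 0 ≤ p 0 η) {b : ℝ} (hs : ∀ τ ∈ Icc 0 b, 0 ≤ s τ) :
    ∀ τ ∈ Icc 0 b, ∀ η ∈ Icc (0 : ℝ) 1, 0 ≤ p τ η := by
  intro τ hτ η hη
  rcases le_total τ η with hle | hle
  · have := h.nonneg_char (η - τ) 0 τ (hp _ ⟨by linarith, by linarith [hτ.1, hη.2]⟩)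
    rwa [sub_add_cancel] at this
  · have := h.nonneg_char (η - τ) (τ - η) τ (by
      rw [sub_add_sub_cancel, sub_self, h.input_eq_left (by linarith)]
      exact add_nonneg (hs _ ⟨by linarith, by linarith [hτ.2, hη.1]⟩) hK0)
    rwa [sub_add_cancel] at this

theorem integral_deriv_eq (h : IsRelaxedSolution K Φ q Q p s) {τ : ℝ} (hτ : 0 ≤ τ) :
    ∫ x in (0 : ℝ)..1, p τ x = Φ := by
  have hc : Continuous (p τ) :=
    h.continuous_deriv.comp (by fun_prop : Continuous fun x : ℝ => (τ, x))
  rw [intervalIntegral.integral_eq_sub_of_hasDerivAt (fun x _ => h.hasDerivAt_right τ x)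
    (hc.intervalIntegrable _ _), h.left τ hτ, h.right τ hτ, sub_zero]

theorem isClassicalSolution (h : IsRelaxedSolution K Φ q Q p s) {Qinit : ℝ → ℝ}
    (hdata : IsAdmissibleData K Φ Qinit) (hq : EqOn q Qinit (Icc 0 1)) {b : ℝ} (hb : 0 < b)
    (hs : ∀ τ ∈ Ico 0 b, 0 < s τ) (hp : ∀ τ ∈ Ico 0 b, ∀ η ∈ Icc (0 : ℝ) 1, 0 ≤ p τ η) :
    IsClassicalSolution K Φ Qinit (b : EReal) Q fun τ => 1 / s τ := by
  have hmem : ∀ τ ∈ timeInterval (b : EReal), τ ∈ Ico 0 b := fun τ hτ =>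
    ⟨hτ.1, EReal.coe_lt_coe_iff.1 hτ.2⟩
  have ho : (1 : ℝ) ∈ Icc (0 : ℝ) 1 := right_mem_Icc.2 zero_le_one
  have hd : ∀ τ, ∀ η ∈ Icc (0 : ℝ) 1, dEta (Q τ) η = p τ η := fun τ η hη =>
    h.dEta_eq τ hη fun _ _ => rfl
  refine ⟨hdata, EReal.coe_pos.2 hb, h.contDiff.contDiffOn, fun τ hτ => ?_,
    continuousOn_const.div h.continuous_input.continuousOn fun τ hτ => (hs τ (hmem τ hτ)).ne',
    fun τ hτ => one_div_pos.2 (hs τ (hmem τ hτ)), fun τ hτ η hη => ?_, fun τ hτ => h.left τ hτ.1,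
    fun τ hτ => ?_, fun η hη => by rw [h.initial η hη, hq hη], fun τ hτ => ?_⟩
  · exact (mem_Icc_of_deriv_nonneg (h.hasDerivAt_right τ) (hp τ (hmem τ hτ)) (h.left τ hτ.1)
      (h.right τ hτ.1)).1
  · rw [hd τ η hη, dTau, (h.hasDerivAt_left τ hτ.1 η).hasDerivWithinAt.derivWithin
      (uniqueDiffOn_Ici 0 τ hτ.1), one_div_one_div]
    ring
  · rw [hd τ 1 ho, one_div_one_div, h.input_eq_right hτ.1]
    ring
  · rw [hd τ 1 ho, h.input_eq_right hτ.1]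
    linarith [hs τ (hmem τ hτ)]

/-- If the input of a relaxed solution is positive up to a first zero `b`, then the solution is the
maximal classical one and its firing rate blows up at `b`. -/
theorem blowsUpAt (h : IsRelaxedSolution K Φ q Q p s) {C : ℝ} (hC0 : 0 ≤ C)
    (hC : ∀ x y, |K x - K y| ≤ C * |x - y|) {Qinit : ℝ → ℝ}
    (hdata : IsAdmissibleData K Φ Qinit) (hq : EqOn q Qinit (Icc 0 1)) {b : ℝ} (hb : 0 < b)
    (hs : ∀ τ ∈ Ico 0 b, 0 < s τ) (hp : ∀ τ ∈ Ico 0 b, ∀ η ∈ Icc (0 : ℝ) 1, 0 ≤ p τ η)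
    (hsb : s b = 0) : BlowsUpAt K Φ Qinit b Q fun τ => 1 / s τ := by
  refine ⟨h.isClassicalSolution hdata hq hb hs hp, fun T Q₁ N₁ h₁ => ⟨?_, fun τ hτ => ?_⟩, ?_⟩
  · by_contra! hT
    have hbT : b ∈ timeInterval T := ⟨hb.le, hT⟩
    have h2 := h₁.input_eq hC0 hC h hq hbT
    have h3 := one_div_pos.2 (h₁.rate_pos b hbT)
    linarith
  · refine ⟨?_, h₁.eqOn_relaxed hC0 hC h hq hτ⟩
    show N₁ τ = 1 / s τ
    rw [← h₁.input_eq hC0 hC h hq hτ, one_div_one_div]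
  · simp only [one_div]
    refine tendsto_inv_nhdsGT_zero.comp (tendsto_nhdsWithin_iff.2 ⟨?_, ?_⟩)
    · have := h.continuous_input.tendsto b
      rw [hsb] at this
      exact this.mono_left nhdsWithin_le_nhds
    · filter_upwards [Ioo_mem_nhdsLT hb] with τ hτ using hs τ (Ioo_subset_Ico_self hτ)

end IsRelaxedSolution

/-! ### First zero of the input and the blow-up theorem -/

theorem exists_first_zero {s : ℝ → ℝ} (hs : Continuous s) (h0 : 0 < s 0)
    (hex : ∃ τ, 0 ≤ τ ∧ s τ ≤ 0) : ∃ b, 0 < b ∧ s b = 0 ∧ ∀ τ ∈ Ico 0 b, 0 < s τ := by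
  set A : Set ℝ := {τ | 0 ≤ τ ∧ s τ ≤ 0} with hA
  have hAc : IsClosed A := (isClosed_le continuous_const continuous_id).inter
    (isClosed_le hs continuous_const)
  have hbdd : BddBelow A := ⟨0, fun τ hτ => hτ.1⟩
  have hmem := hAc.csInf_mem hex hbdd
  have hpos : ∀ τ ∈ Ico 0 (sInf A), 0 < s τ := fun τ hτ => by
    by_contra! h
    exact absurd (csInf_le hbdd ⟨hτ.1, h⟩) (not_le.2 hτ.2)
  have hb : 0 < sInf A := hmem.1.lt_of_ne fun h => by
    have := hmem.2
    rw [← h] at this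
    linarith
  refine ⟨sInf A, hb, le_antisymm hmem.2 ?_, hpos⟩
  have ht : Tendsto s (𝓝[<] sInf A) (𝓝 (s (sInf A))) :=
    (hs.tendsto _).mono_left nhdsWithin_le_nhds
  refine ge_of_tendsto ht ?_
  filter_upwards [Ioo_mem_nhdsLT hb] with τ hτ using (hpos τ (Ioo_subset_Ico_self hτ)).le

theorem corollary6p2 (K : ℝ → ℝ) (ΦF : ℝ) (hΦF : 0 < ΦF) (hK : IsPhaseResponse K ΦF)
    (hkmin : 0 < kMin K ΦF) (hss : 1 < ∫ φ in (0 : ℝ)..ΦF, 1 / K φ) :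
    ∃ Qs : ℝ → ℝ,
      IsSteadyState K ΦF Qs ∧
      (∀ q : ℝ → ℝ, IsSteadyState K ΦF q → EqOn q Qs (Icc 0 1)) ∧
      ∀ Qinit : ℝ → ℝ, IsCompatibleData K ΦF Qinit → ¬ IsSteadyState K ΦF Qinit →
        0 < distBV Qinit Qs ∧
        ∃ (τstar : ℝ) (Q : ℝ → ℝ → ℝ) (N : ℝ → ℝ),
          BlowsUpAt K ΦF Qinit τstar Q N ∧
          τstar ≤ 1 / kMin K ΦF * Real.log (2 * ΦF / distBV Qinit Qs) := by
  obtain ⟨C, hCK⟩ := hK.bounded_deriv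
  have hC0 : 0 ≤ C := (abs_nonneg _).trans (hCK 0)
  have hK1 : ContDiff ℝ 1 K := hK.contDiff.of_le one_le_two
  have hC := abs_sub_le_of_abs_deriv_le (hK1.differentiable one_ne_zero) hCK
  have hz : (0 : ℝ) ∈ Icc (0 : ℝ) 1 := left_mem_Icc.2 zero_le_one
  have ho : (1 : ℝ) ∈ Icc (0 : ℝ) 1 := right_mem_Icc.2 zero_le_one
  have hK0 : 0 ≤ K 0 := (hK.pos 0 (left_mem_Icc.2 hΦF.le)).le
  obtain ⟨c, g, hc, hgC, hg0, hg1, hgm, hgd⟩ :=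
    exists_steadyProfile hΦF hK1.continuous hK.pos hss
  have hsteady : ∀ q, EqOn q g (Icc 0 1) → IsSteadyState K ΦF q := fun q hq =>
    isSteadyState_of_eqOn hK.pos hc hgC hg0 hg1 hgm hgd hq
  refine ⟨g, hsteady g fun _ _ => rfl, fun q hq => hq.eqOn_profile hΦF hK1.continuous hC0 hC
    hK.pos hc hg0 hg1 hgm hgd, fun Qinit hQ hns => ?_⟩
  obtain ⟨f, hfC, hfQ, hfd⟩ := exists_contDiff_extension hQ.contDiffOn
  obtain ⟨Q, p, s, hrel⟩ := exists_isRelaxedSolution (ΦF := ΦF) hK1 hCK hfC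
    (by rw [hfQ hz, hQ.map_zero]) (by rw [hfQ ho, hQ.map_one])
    (by rw [hfd 1 ho, hfd 0 hz]; exact hQ.compatible)
  obtain ⟨Q', p', s', hrel'⟩ := exists_isRelaxedSolution (ΦF := ΦF) hK1 hCK hgC hg0 hg1
    (by rw [(hgd 1 ho).deriv, (hgd 0 hz).deriv, hg0, hg1]; ring)
  obtain ⟨N, hN⟩ := hsteady g fun _ _ => rfl
  -- The steady state is a global classical solution, so the relaxed solution starting from `g`
  -- stays equal to `g` on `[0, 1]`.
  have hp' : ∀ τ, 0 ≤ τ → ∀ η ∈ Icc (0 : ℝ) 1, dEta g η = p' τ η := fun τ hτ η hη =>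
    hrel'.dEta_eq τ hη (hN.eqOn_relaxed hC0 hC hrel' (fun _ _ => rfl)
      ⟨hτ, EReal.coe_lt_top τ⟩)
  have hp'0 : ∀ τ, 0 ≤ τ → ∀ η ∈ Icc (0 : ℝ) 1, 0 ≤ p' τ η := fun τ hτ η hη => by
    rw [← hp' τ hτ η hη, dEta, (hgd η hη).hasDerivWithinAt.derivWithin
      (uniqueDiffOn_Icc zero_lt_one η hη)]
    exact (add_pos hc (hK.pos _ (hgm η hη))).le
  have hp0 : ∀ η ∈ Icc (0 : ℝ) 1, dEta Qinit η = p 0 η := fun η hη =>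
    hrel.dEta_eq 0 hη fun x hx => by rw [hrel.initial x hx, hfQ hx]
  have hp0n : ∀ η ∈ Icc (0 : ℝ) 1, 0 ≤ p 0 η := fun η hη => by
    rw [← hp0 η hη]; exact hQ.monotoneOn.derivWithin_nonneg
  have hdist : distBV Qinit g = ∫ x in (0 : ℝ)..1, |p 0 x - p' 0 x| := by
    refine intervalIntegral.integral_congr fun x hx => ?_
    rw [uIcc_of_le zero_le_one] at hx
    simp only [hp0 x hx, hp' 0 le_rfl x hx]
  have hpc : ∀ τ, Continuous (p τ) := fun τ =>
    hrel.continuous_deriv.comp (by fun_prop : Continuous fun x : ℝ => (τ, x))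
  have hpc' : ∀ τ, Continuous (p' τ) := fun τ =>
    hrel'.continuous_deriv.comp (by fun_prop : Continuous fun x : ℝ => (τ, x))
  -- At distance zero the continuous derivatives agree everywhere, so the data would coincide with
  -- the steady state.
  have hL0 : 0 < ∫ x in (0 : ℝ)..1, |p 0 x - p' 0 x| := by
    by_contra hL
    have hpp : ∀ x ∈ Icc (0 : ℝ) 1, p 0 x - p' 0 x = 0 := fun x hx => by
      by_contra hne
      exact hL (intervalIntegral.integral_pos zero_lt_one
        ((hpc 0).sub (hpc' 0)).abs.continuousOn (fun _ _ => abs_nonneg _)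
        ⟨x, hx, abs_pos.2 hne⟩)
    refine hns (hsteady Qinit fun x hx => ?_)
    have h1 := eq_of_has_deriv_right_eq (a := 0) (b := 1) (f := Q 0) (g := Q' 0) (f' := p 0)
      (fun y _ => (hrel.hasDerivAt_right 0 y).hasDerivWithinAt)
      (fun y hy => by
        rw [sub_eq_zero.1 (hpp y (Ico_subset_Icc_self hy))]
        exact (hrel'.hasDerivAt_right 0 y).hasDerivWithinAt)
      (fun y _ => (hrel.hasDerivAt_right 0 y).continuousAt.continuousWithinAt)
      (fun y _ => (hrel'.hasDerivAt_right 0 y).continuousAt.continuousWithinAt)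
      (by rw [hrel.left 0 le_rfl, hrel'.left 0 le_rfl]) x hx
    rw [← hfQ hx, ← hrel.initial x hx, h1, hrel'.initial x hx]
  rw [hdist]
  -- Stated for any interval on which `s ≥ 0`, so that it serves twice: to show that `s` has a zero,
  -- and to bound the first one.
  have hbound : ∀ b, 0 ≤ b → (∀ τ ∈ Icc 0 b, 0 ≤ s τ) →
      b ≤ 1 / kMin K ΦF * Real.log (2 * ΦF / ∫ x in (0 : ℝ)..1, |p 0 x - p' 0 x|) := by
    intro b hb hs
    have hpn := hrel.deriv_nonneg hK0 hp0n hs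
    have h1 := hrel.integral_abs_sub_ge hK.contDiff hrel' hb
      (fun τ hτ => hpn τ (Ico_subset_Icc_self hτ)) (fun τ hτ => hp'0 τ hτ.1)
      (fun τ hτ => by
        rw [hrel.input_eq_left hτ.1, hrel'.input_eq_left hτ.1, hrel.input_eq_right hτ.1,
          hrel'.input_eq_right hτ.1]
        ring)
    have h2 : ∫ x in (0 : ℝ)..1, |p b x - p' b x| ≤ 2 * ΦF := by
      calc _ ≤ ∫ x in (0 : ℝ)..1, (p b x + p' b x) := by
            refine intervalIntegral.integral_mono_on zero_le_one
              (((hpc b).sub (hpc' b)).abs.intervalIntegrable _ _)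
              (((hpc b).add (hpc' b)).intervalIntegrable _ _) fun x hx => ?_
            have h3 := hpn b (right_mem_Icc.2 hb) x hx
            have h4 := hp'0 b hb x hx
            rw [abs_le]
            constructor <;> linarith
        _ = 2 * ΦF := by
            rw [intervalIntegral.integral_add ((hpc b).intervalIntegrable _ _)
              ((hpc' b).intervalIntegrable _ _), hrel.integral_deriv_eq hb,
              hrel'.integral_deriv_eq hb]
            ring
    have h3 : Real.exp (kMin K ΦF * b) ≤ 2 * ΦF / ∫ x in (0 : ℝ)..1, |p 0 x - p' 0 x| := by
      rw [le_div_iff₀ hL0, mul_comm]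
      exact h1.trans h2
    have h4 := (Real.le_log_iff_exp_le (by positivity)).2 h3
    rw [one_div, inv_mul_eq_div, le_div_iff₀ hkmin, mul_comm]
    exact h4
  have hs0 : 0 < s 0 := by
    have h1 := hQ.lt_deriv_one
    rw [hp0 1 ho, hrel.input_eq_right le_rfl] at h1
    linarith
  -- If `s` stayed positive forever, `hbound` would apply beyond its own bound `B`.
  obtain ⟨b, hb, hsb, hs⟩ := exists_first_zero hrel.continuous_input hs0 (by
    by_contra! h
    set B := 1 / kMin K ΦF * Real.log (2 * ΦF / ∫ x in (0 : ℝ)..1, |p 0 x - p' 0 x|) with hB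
    have := hbound (max 0 (B + 1)) (le_max_left _ _) fun τ hτ => (h τ hτ.1).le
    have := le_max_right 0 (B + 1)
    linarith)
  have hsn : ∀ τ ∈ Icc 0 b, 0 ≤ s τ := fun τ hτ => by
    rcases hτ.2.eq_or_lt with h | h
    · rw [h, hsb]
    · exact (hs τ ⟨hτ.1, h⟩).le
  refine ⟨hL0, b, Q, fun τ => 1 / s τ, ?_, hbound b hb.le hsn⟩
  exact hrel.blowsUpAt hC0 hC hQ.toIsAdmissibleData hfQ hb hs
    (fun τ hτ => hrel.deriv_nonneg hK0 hp0n hsn τ (Ico_subset_Icc_self hτ)) hsb
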